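/- Let $W_n(q)=\sum_{k=0}^n\binom nk^2q^k$ be the Narayana polynomials of type $B$, let $H=(W_{i+j}(q))_{i,j\ge0}$ and $H_n=(W_{i+j}(q))_{0\le i,j\le n}$. **The network.** For $n\ge 0$ let $D^{H_n}$ be the following weighted digraph (with multiple arcs). Its vertices are $P^{(i)}_j$ ($0\le i,j\le n$), $Q^{(i)}_j$ ($0\le i<n$, $0\le j\le i+1$), and their mirror images $\bar P^{(i)}_j$, $\bar Q^{(i)}_j$. For each $0\le i<n$ the $i$-th layer consists of the arcs - $P^{(i)}_j\to P^{(i+1)}_j$ ($i+2\le j\le n$), of weight $1$; - $P^{(i)}_j\to Q^{(i)}_j$ and $Q^{(i)}_j\to P^{(i+1)}_j$ ($0\le j\le i+1$), of weight $1$; - $P^{(i)}_j\to Q^{(i)}_{j+1}$ ($0\le j\le i$), of weight $q$; - $Q^{(i)}_j\to P^{(i+1)}_{j+1}$ ($0\le j<i$), of weight $1$; - $P^{(i)}_i\to P^{(i+1)}_{i+1}$, of weight $-1$; - two parallel arcs $Q^{(i)}_i\overset{l}{\to}P^{(i+1)}_{i+1}$ and $Q^{(i)}_i\overset{r}{\to}P^{(i+1)}_{i+1}$,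 each of weight $1$. The mirror image of a layer has the arc $\bar v\to\bar u$, with the same weight, for each arc $u\to v$ of the layer. Finally there are the arcs $P^{(n)}_j\to\bar P^{(n)}_j$ ($0\le j\le n$), of weight $1$ for $j=n$ and $2q^{n-j}$ for $j<n$; they form the middle segment. Thus $D^{H_n}$ is divided into $2n+1$ segments: $n$ layers, the middle segment, and the $n$ mirror images of the layers. The weight of a directed path is the product of the weights of its arcs, and the weight of a family of paths is the product of the weights of its members. **The families.** Let $I=(i_1<\dots<i_k)$ and $J=(j_1<\dots<j_k)$ be sequences in $\{0,\dots,n\}$. Let $\mathcal N_{I,J}$ be the set of families $\mathbf p=(p_1,\dots,p_k)$ of pairwise vertex-disjoint directed paths in $D^{H_n}$, $p_m$ running from $P^{(0)}_{n-i_m}$ to $\bar P^{(0)}_{n-j_m}$. Let $\mathcal S^{H_n}_{I,J}$ be the set of those $\mathbf p\in\mathcal N_{I,J}$ such that, for every $0\le i<n$, neither the restriction of $\mathbf p$ to the $i$-th layer nor the reflection of its restriction to the mirror image of the $i$-th layer has one of the following properties: 1. some component is $P^{(i)}_i\to P^{(i+1)}_{i+1}$; 2. some component is $P^{(i)}_i\to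 Q^{(i)}_i\overset{l}{\to}P^{(i+1)}_{i+1}$; 3. for some $j\ge1$ and $l\ge2$, the $(j+l-1)$-th component is $P^{(i)}_{i+1-l}\to Q^{(i)}_{i+1-l}\to P^{(i+1)}_{i+2-l}$, and the $(j+t)$-th component is $P^{(i)}_{i-t}\to Q^{(i)}_{i+1-t}\to P^{(i+1)}_{i+1-t}$ for each $0\le t\le l-2$. **Theorem.** For all $n$, $I$, $J$ as above, $\mathcal N_{I,J}$ is finite and $$\det[H_{I,J}]=GF(\mathcal S^{H_n}_{I,J}),$$ where $H_{I,J}$ is the submatrix of $H_n$ with rows $I$ and columns $J$, and $GF(\mathcal S^{H_n}_{I,J})$ is the sum of the weights of all elements of $\mathcal S^{H_n}_{I,J}$. Moreover, there is an involution $\varphi$ of $\mathcal N_{I,J}$ with fixed-point set exactly $\mathcal S^{H_n}_{I,J}$ such that $\varphi(\mathbf p)$ has the opposite weight of $\mathbf p$ for each $\mathbf p\notin\mathcal S^{H_n}_{I,J}$, and such that $\varphi(\mathbf p)$ always agrees with $\mathbf p$ on all of the $2n+1$ segments except at most one. In particular, $H$ is $q$-totally positive: every minor of $H$ is a polynomial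 in $q$ with nonnegative coefficients. -/

import Mathlib

open Polynomial

namespace NarayanaB

/-! ### Narayana polynomials of type B, their Hankel matrix, and q-total positivity -/

/-- The `n`-th Narayana polynomial of type B, `W_n(q) = ∑_k (n choose k)² q^k`. -/
noncomputable def narayana (n : ℕ) : ℝ[X] :=
  ∑ k ∈ Finset.range (n + 1), C ((n.choose k : ℝ) ^ 2) * X ^ k

/-- The infinite Hankel matrix `H = (W_{i+j}(q))_{i,j ≥ 0}`. -/
noncomputable def hankel : Matrix ℕ ℕ ℝ[X] :=
  Matrix.of fun i j => narayana (i + j)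

/-- The truncated Hankel matrix `H_n = (W_{i+j}(q))_{0 ≤ i,j ≤ n}`. -/
noncomputable def hankelTrunc (n : ℕ) : Matrix (Fin (n + 1)) (Fin (n + 1)) ℝ[X] :=
  Matrix.of fun i j => narayana ((i : ℕ) + (j : ℕ))

/-- A polynomial is `q`-nonnegative if all its coefficients are nonnegative. -/
def QNonneg (f : ℝ[X]) : Prop :=
  ∀ d : ℕ, 0 ≤ f.coeff d

/-- An infinite matrix of polynomials is `q`-totally positive if all its minors are
`q`-nonnegative. -/
def QTotallyPositive (M : Matrix ℕ ℕ ℝ[X]) : Prop :=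
  ∀ (k : ℕ) (I J : Fin k → ℕ), StrictMono I → StrictMono J → QNonneg (M.submatrix I J).det

/-! ### The network for `B_n`

The digraph `D^{B_n}` consists of `n` consecutive layers. Layer `i` (`0 ≤ i < n`) runs from the
vertices `P^{(i)}_j` through the vertices `Q^{(i)}_j` to the vertices `P^{(i+1)}_j`. It is a copy
of the network of the matrix `L^B_i` (the leading block of size `i + 2` of the coefficient matrix
`L^B`), together with horizontal arcs `P^{(i)}_j ⟶ P^{(i+1)}_j` for `i + 2 ≤ j ≤ n`.
The vertices `P_m`, `Q_m`, `P'_m` (`0 ≤ m ≤ i + 1`) of the network of `L^B_i` are called here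
`P^{(i)}_{i+1-m}`, `Q^{(i)}_{i+1-m}`, `P^{(i+1)}_{i+1-m}`. -/

/-- The vertices `P^{(i)}_j` (`0 ≤ i, j ≤ n`) and `Q^{(i)}_j` (`0 ≤ i < n`, `0 ≤ j ≤ i + 1`) of
`D^{B_n}`. -/
inductive BVertex (n : ℕ) : Type
  | P (i j : ℕ) (hi : i ≤ n) (hj : j ≤ n) : BVertex n
  | Q (i j : ℕ) (hi : i < n) (hj : j ≤ i + 1) : BVertex n

/-- The arcs of `D^{B_n}`. -/
inductive BArc (n : ℕ) : BVertex n → BVertex n → Type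
  /-- the horizontal arc `P^{(i)}_j ⟶ P^{(i+1)}_j` above the copy of the network of `L^B_i` -/
  | horiz (i j : ℕ) (hi : i < n) (hij : i + 2 ≤ j) (hj : j ≤ n) :
      BArc n (.P i j (by omega) hj) (.P (i + 1) j (by omega) hj)
  /-- `P_m ⟶ Q_m`, `m ≥ 0`, that is, `P^{(i)}_j ⟶ Q^{(i)}_j` -/
  | pq (i j : ℕ) (hi : i < n) (hj : j ≤ i + 1) :
      BArc n (.P i j (by omega) (by omega)) (.Q i j hi hj)
  /-- `P_m ⟶ Q_{m-1}`, `m ≥ 1`, that is, `P^{(i)}_j ⟶ Q^{(i)}_{j+1}` -/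
  | pqUp (i j : ℕ) (hi : i < n) (hj : j ≤ i) :
      BArc n (.P i j (by omega) (by omega)) (.Q i (j + 1) hi (by omega))
  /-- `Q_m ⟶ P'_m`, `m ≥ 0`, that is, `Q^{(i)}_j ⟶ P^{(i+1)}_j` -/
  | qp (i j : ℕ) (hi : i < n) (hj : j ≤ i + 1) :
      BArc n (.Q i j hi hj) (.P (i + 1) j (by omega) (by omega))
  /-- `Q_m ⟶ P'_{m-1}`, `m ≥ 2`, that is, `Q^{(i)}_j ⟶ P^{(i+1)}_{j+1}` -/
  | qpUp (i j : ℕ) (hi : i < n) (hj : j < i) :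
      BArc n (.Q i j hi (by omega)) (.P (i + 1) (j + 1) (by omega) (by omega))
  /-- `P_1 ⟶ P'_0`, that is, `P^{(i)}_i ⟶ P^{(i+1)}_{i+1}` -/
  | skip (i : ℕ) (hi : i < n) :
      BArc n (.P i i (by omega) (by omega)) (.P (i + 1) (i + 1) (by omega) (by omega))
  /-- the left one of the two arcs `Q_1 ⟶ P'_0`, that is, `Q^{(i)}_i ⟶ P^{(i+1)}_{i+1}` -/
  | qpLeft (i : ℕ) (hi : i < n) :
      BArc n (.Q i i hi (by omega)) (.P (i + 1) (i + 1) (by omega) (by omega))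
  /-- the right one of the two arcs `Q_1 ⟶ P'_0`, that is, `Q^{(i)}_i ⟶ P^{(i+1)}_{i+1}` -/
  | qpRight (i : ℕ) (hi : i < n) :
      BArc n (.Q i i hi (by omega)) (.P (i + 1) (i + 1) (by omega) (by omega))

namespace BArc

variable {n : ℕ}

/-- The weights: `q` on `P_m ⟶ Q_{m-1}`, `-1` on `P_1 ⟶ P'_0`, and `1` on all other arcs. -/
noncomputable def weight : ∀ {u v : BVertex n}, BArc n u v → ℝ[X]
  | _, _, pqUp .. => X
  | _, _, skip .. => -1
  | _, _, horiz .. => 1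
  | _, _, pq .. => 1
  | _, _, qp .. => 1
  | _, _, qpUp .. => 1
  | _, _, qpLeft .. => 1
  | _, _, qpRight .. => 1

/-- The layer in which an arc of `D^{B_n}` lies. -/
def layer : ∀ {u v : BVertex n}, BArc n u v → ℕ
  | _, _, horiz i .. => i
  | _, _, pq i .. => i
  | _, _, pqUp i .. => i
  | _, _, qp i .. => i
  | _, _, qpUp i .. => i
  | _, _, skip i .. => i
  | _, _, qpLeft i .. => i
  | _, _, qpRight i .. => i

end BArc

/-! ### The network for `H_n = B_n T_n B_n^t` -/

/-- The vertices of `D^{H_n}`: the vertices `v` of `D^{B_n}` and their mirror images `v̄`. -/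
inductive Vertex (n : ℕ) : Type
  | left (v : BVertex n) : Vertex n
  | right (v : BVertex n) : Vertex n

/-- The arcs of `D^{H_n}`: the arcs of `D^{B_n}`, the arcs `P^{(n)}_j ⟶ P̄^{(n)}_j` of the network
of the diagonal matrix `T_n`, and the reversed mirror images of the arcs of `D^{B_n}`. -/
inductive Arc (n : ℕ) : Vertex n → Vertex n → Type
  | left {u v : BVertex n} (a : BArc n u v) : Arc n (.left u) (.left v)
  | middle (j : ℕ) (hj : j ≤ n) :
      Arc n (.left (.P n j le_rfl hj)) (.right (.P n j le_rfl hj))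
  | right {u v : BVertex n} (a : BArc n u v) : Arc n (.right v) (.right u)

instance (n : ℕ) : Quiver (Vertex n) where
  Hom := Arc n

/-- The diagonal entries `1, 2q, 2q², …` of `T_n`. -/
noncomputable def tEntry (m : ℕ) : ℝ[X] :=
  if m = 0 then 1 else 2 * X ^ m

namespace Arc

variable {n : ℕ}

/-- The weights in `D^{H_n}`. The vertex `P^{(n)}_j` stands for the row and column `n - j`
of `T_n`. -/
noncomputable def weight : ∀ {u v : Vertex n}, (u ⟶ v) → ℝ[X]
  | _, _, left a => a.weight
  | _, _, middle j _ => tEntry (n - j)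
  | _, _, right a => a.weight

end Arc

/-- The `2n + 1` segments of `D^{H_n}`: the `n` layers of `D^{B_n}`, the network of `T_n`, and the
mirror images of the `n` layers. -/
inductive Segment : Type
  | left (i : ℕ) : Segment
  | middle : Segment
  | right (i : ℕ) : Segment

/-- The segment in which an arc of `D^{H_n}` lies. -/
def Arc.segment {n : ℕ} : ∀ {u v : Vertex n}, (u ⟶ v) → Segment
  | _, _, left a => .left a.layer
  | _, _, middle .. => .middle
  | _, _, right a => .right a.layer

/-- An arc of `D^{H_n}` bundled with its end points. -/
abbrev AnyArc (n : ℕ) : Type := Σ u v : Vertex n, u ⟶ v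

/-- The image of an arc under the reflection of `D^{H_n}`. -/
def reflectArc {n : ℕ} : AnyArc n → AnyArc n
  | ⟨_, _, .left a⟩ => ⟨_, _, .right a⟩
  | ⟨_, _, .middle j hj⟩ => ⟨_, _, .middle j hj⟩
  | ⟨_, _, .right a⟩ => ⟨_, _, .left a⟩

/-- The image of a sequence of consecutive arcs under the reflection, which reverses the arcs and
hence the order in which they are traversed. -/
def reflect {n : ℕ} (l : List (AnyArc n)) : List (AnyArc n) :=
  (l.map reflectArc).reverse

/-- An arc of `D^{B_n}` as an arc of `D^{H_n}`. -/
def lArc {n : ℕ} {u v : BVertex n} (a : BArc n u v) : AnyArc n :=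
  ⟨.left u, .left v, Arc.left a⟩

open Classical in
/-- The restriction of a directed path to a segment, as the sequence of its arcs in there. -/
noncomputable def restrict {n : ℕ} (s : Segment) {u : Vertex n} :
    ∀ {v : Vertex n}, Quiver.Path u v → List (AnyArc n)
  | _, .nil => []
  | _, .cons p a => restrict s p ++ if Arc.segment a = s then [⟨_, _, a⟩] else []

/-! ### Nonintersecting families -/

/-- The vertex `P^{(0)}_{n-i}` of `D^{H_n}`, which stands for row `i`. -/
def rowVertex {n : ℕ} (i : Fin (n + 1)) : Vertex n :=
  .left (.P 0 (n - i) (Nat.zero_le n) (Nat.sub_le n i))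

/-- The vertex `P̄^{(0)}_{n-j}` of `D^{H_n}`, which stands for column `j`. -/
def colVertex {n : ℕ} (j : Fin (n + 1)) : Vertex n :=
  .right (.P 0 (n - j) (Nat.zero_le n) (Nat.sub_le n j))

/-- Families `(p_1, …, p_k)` of directed paths, `p_m` running from `P^{(0)}_{n-i_m}` to
`P̄^{(0)}_{n-j_m}`. -/
abbrev Family {n k : ℕ} (I J : Fin k → Fin (n + 1)) : Type :=
  ∀ m : Fin k, Quiver.Path (rowVertex (I m)) (colVertex (J m))

variable {n k : ℕ} {I J : Fin k → Fin (n + 1)}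

/-- The weight of a family is the product of the weights of its paths. -/
noncomputable def familyWeight (p : Family I J) : ℝ[X] :=
  ∏ m, (p m).weight Arc.weight

variable (I J) in
/-- The set of nonintersecting families: different paths have no vertex in common. -/
def nonintersecting : Set (Family I J) :=
  {p | ∀ m m' : Fin k, m ≠ m' → ∀ v, v ∈ (p m).vertices → v ∉ (p m').vertices}

/-- `c` lists, for one segment, the components of a family restricted to the `i`-th layer, and
this is the first excluded property: some component is `P^{(i)}_i ⟶ P^{(i+1)}_{i+1}`. -/
def Prop1 (i : ℕ) (hi : i < n) (c : Fin k → List (AnyArc n)) : Prop :=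
  ∃ j, c j = [lArc (.skip i hi)]

/-- The second excluded property: some component is
`P^{(i)}_i ⟶ Q^{(i)}_i ⟶ P^{(i+1)}_{i+1}`, where the second arc is the left one. -/
def Prop2 (i : ℕ) (hi : i < n) (c : Fin k → List (AnyArc n)) : Prop :=
  ∃ j, c j = [lArc (.pq i i hi (by omega)), lArc (.qpLeft i hi)]

/-- The third excluded property: for some `j` and some `l ≥ 2`, the component number `j + l - 1` is
`P^{(i)}_{i+1-l} ⟶ Q^{(i)}_{i+1-l} ⟶ P^{(i+1)}_{i+2-l}`, and the component number `j + t` is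
`P^{(i)}_{i-t} ⟶ Q^{(i)}_{i+1-t} ⟶ P^{(i+1)}_{i+1-t}` for `0 ≤ t ≤ l - 2`. -/
def Prop3 (i : ℕ) (hi : i < n) (c : Fin k → List (AnyArc n)) : Prop :=
  ∃ (j l : ℕ) (hl : 2 ≤ l) (hli : l ≤ i + 1) (hk : j + l - 1 < k),
    c ⟨j + l - 1, hk⟩ =
      [lArc (.pq i (i + 1 - l) hi (by omega)), lArc (.qpUp i (i + 1 - l) hi (by omega))] ∧
    ∀ (t : ℕ) (ht : t ≤ l - 2), c ⟨j + t, by omega⟩ =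
      [lArc (.pqUp i (i - t) hi (by omega)), lArc (.qp i (i - t + 1) hi (by omega))]

variable (I J) in
/-- The set `S^{H_n}_{I,J}` of the nonintersecting families whose restriction to any layer, and
the preimage under the reflection of whose restriction to the mirror image of any layer, has none
of the three excluded properties. -/
def goodFamilies : Set (Family I J) :=
  {p | p ∈ nonintersecting I J ∧ ∀ (i : ℕ) (hi : i < n),
    (¬ Prop1 i hi (fun m => restrict (.left i) (p m)) ∧
      ¬ Prop2 i hi (fun m => restrict (.left i) (p m)) ∧
      ¬ Prop3 i hi (fun m => restrict (.left i) (p m))) ∧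
    (¬ Prop1 i hi (fun m => reflect (restrict (.right i) (p m))) ∧
      ¬ Prop2 i hi (fun m => reflect (restrict (.right i) (p m))) ∧
      ¬ Prop3 i hi (fun m => reflect (restrict (.right i) (p m))))}

/-- The generating function of a set of families, the sum of their weights. -/
noncomputable def GF (S : Set (Family I J)) : ℝ[X] :=
  ∑ᶠ p ∈ S, familyWeight p

/-- `φ` is a segment-wise sign-reversing involution of the nonintersecting families with
fixed-point set `S`: it is an involution with this fixed-point set, it negates the weight of each
family outside `S`, and it changes a family in at most one segment. -/
structure IsSegmentwiseSignReversing (S : Set (Family I J))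
    (φ : nonintersecting I J → nonintersecting I J) : Prop where
  involutive : Function.Involutive φ
  fixed_iff : ∀ p, φ p = p ↔ p.1 ∈ S
  weight_neg : ∀ p, p.1 ∉ S → familyWeight (φ p).1 = -familyWeight p.1
  segmentwise : ∀ p, ∃ s₀ : Segment, ∀ s, s ≠ s₀ →
    ∀ m, restrict s ((φ p).1 m) = restrict s (p.1 m)

end NarayanaB

namespace NarayanaB

/-! ### Minors of products of matrices -/

/-! The proof has three ingredients: a factorization `H_n = B_n T_n B_n^t`, a determinantal path
count, and a local cancellation.

Factorization. `B_n` has the entries `narayanaCoeff m k`. Pascal's rule gives them a tridiagonal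
recurrence in `m` (`narayanaCoeff_succ_succ`, `narayanaCoeff_succ_zero`), and the tridiagonal
operator is self-adjoint for the form with diagonal `T`. Hence the form on rows `m` and `l` depends
only on `m + l`. Row `0` is a unit vector, so the value is `W_{m+l}` (`sum_tEntry_eq_narayana`). The
same recurrence shows that the `i`-th layer of the network turns the triangle for `i` into the one
for `i + 1` (`networkEntry_succ`). The boundary entry `2q` of the recurrence is produced by the two
parallel arcs; they would also spoil a neighbouring entry, and the arc of weight `-1` repairs it.

Path count. Instead of a tail-swapping argument, each layer is cut at its vertices `Q` into two
matrices of noncrossing arcs. A minor of such a matrix is a single product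
(`Noncrossing.det_submatrix`), so Cauchy–Binet, applied half-layer by half-layer, expands a minor of
`H_n` into a sum over families of disjoint paths. Such a family is encoded by its positions between
layers and the `Kind` of each passage; passages of one layer are disjoint exactly when their heights
`Kind.mid` decrease strictly.

Cancellation. Within a layer, suppose that the positions `s, …, i` are all occupied and that each of
their paths rises by one. If the path from `s` rises late and the others early, the contribution is
`q^(i-s)`. If the path from `i` takes the negative arc and the others rise early, it is `-q^(i-s)`.
The ends agree, so `LayerFam.flip` exchanges the two patterns, with `s` chosen least in the second
one. The excluded properties say precisely that one of the patterns occurs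
(`LayerFam.excluded_iff`). Flipping the first layer in which this happens, with the left half before
the mirrored half, gives the involution. Its fixed points avoid the only negative arc, which yields
nonnegativity.

What remains is the dictionary between this encoding and actual paths, the bijection
`FullFam.equiv`. -/

/-- The strictly decreasing sequences of length `k` in `γ`. -/
abbrev DecSeq (k : ℕ) (γ : Type*) [Preorder γ] : Type _ := {g : Fin k → γ // StrictAnti g}

noncomputable instance (k : ℕ) (γ : Type*) [Preorder γ] [Finite γ] : Fintype (DecSeq k γ) :=
  Fintype.ofFinite _

/-- Sorting is unique: a strictly decreasing sequence is determined by its range, which permuting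
the indices does not change. -/
theorem strictAnti_comp_perm_injective {k : ℕ} {γ : Type*} [LinearOrder γ] :
    Function.Injective
      (fun x : DecSeq k γ × Equiv.Perm (Fin k) => (x.1 : Fin k → γ) ∘ x.2) := by
  rintro ⟨⟨g, hg⟩, σ⟩ ⟨⟨g', hg'⟩, σ'⟩ h
  simp only at h
  have hr : Set.range (OrderDual.toDual ∘ g) = Set.range (OrderDual.toDual ∘ g') := by
    have h1 : Set.range g = Set.range g' := by
      rw [← σ.surjective.range_comp g, h, σ'.surjective.range_comp]
    rw [Set.range_comp, Set.range_comp, h1]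
  have hgg : g = g' := (StrictMono.range_inj hg.dual_right hg'.dual_right).1 hr
  subst hgg
  have : σ = σ' := by
    ext x
    rw [hg.injective (congrFun h x)]
  rw [this]

theorem exists_strictAnti_comp_perm {k : ℕ} {γ : Type*} [LinearOrder γ] (f : Fin k → γ)
    (hf : Function.Injective f) :
    ∃ x : DecSeq k γ × Equiv.Perm (Fin k), (x.1 : Fin k → γ) ∘ x.2 = f := by
  have hm : StrictMono (f ∘ Tuple.sort f) :=
    (Tuple.monotone_sort f).strictMono_of_injective (hf.comp (Tuple.sort f).injective)
  refine ⟨⟨⟨f ∘ Tuple.sort f ∘ Fin.revPerm, fun a b hab => hm (Fin.rev_lt_rev.2 hab)⟩,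
    (Tuple.sort f)⁻¹.trans Fin.revPerm⟩, ?_⟩
  ext x
  simp

/-- The Cauchy–Binet formula. -/
theorem det_mul_eq_sum_decSeq {R : Type*} [CommRing R] {k : ℕ} {γ : Type*} [Fintype γ]
    [LinearOrder γ] (A : Matrix (Fin k) γ R) (B : Matrix γ (Fin k) R) :
    (A * B).det = ∑ g : DecSeq k γ, (A.submatrix id g.1).det * (B.submatrix g.1 id).det := by
  -- Row `i` of `A * B` is a combination of the rows of `B`; expand multilinearly over the choice
  -- `f` of one row of `B` for each `i`.
  have h1 : (A * B).det = ∑ f : Fin k → γ, (∏ i, A i (f i)) * (B.submatrix f id).det := by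
    have : (A * B) = fun i => ∑ c, A i c • B c := by
      ext i j
      simp [Matrix.mul_apply]
    rw [this]
    refine (MultilinearMap.map_sum (Matrix.detRowAlternating).toMultilinearMap
      (fun i c => A i c • B c)).trans (Finset.sum_congr rfl fun f _ => ?_)
    exact MultilinearMap.map_smul_univ (Matrix.detRowAlternating).toMultilinearMap
      (fun i => A i (f i)) (fun i => B (f i))
  have h2 : ∀ (g : DecSeq k γ), (A.submatrix id g.1).det * (B.submatrix g.1 id).det =
      ∑ σ : Equiv.Perm (Fin k), (∏ i, A i (g.1 (σ i))) * (B.submatrix (g.1 ∘ σ) id).det := by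
    intro g
    rw [← Matrix.det_transpose (A.submatrix id g.1), Matrix.det_apply', Finset.sum_mul]
    refine Finset.sum_congr rfl fun σ _ => ?_
    have : B.submatrix (g.1 ∘ σ) id = (B.submatrix g.1 id).submatrix σ id := rfl
    rw [this, Matrix.det_permute]
    simp only [Matrix.transpose_apply, Matrix.submatrix_apply, id]
    ring
  rw [h1, Finset.sum_congr rfl fun g _ => h2 g, ← Fintype.sum_prod_type']
  symm
  refine Fintype.sum_of_injective
    (fun x : DecSeq k γ × Equiv.Perm (Fin k) => (x.1 : Fin k → γ) ∘ x.2)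
    strictAnti_comp_perm_injective _ _ (fun f hf => ?_) (fun _ => rfl)
  -- A choice that is not a permuted decreasing sequence repeats a row of `B` and contributes zero.
  have : ¬ Function.Injective f := fun h => hf (exists_strictAnti_comp_perm f h)
  simp only [Function.Injective, not_forall] at this
  obtain ⟨a, b, hab, hne⟩ := this
  rw [Matrix.det_zero_of_row_eq hne, mul_zero]
  ext c
  simp [hab]

/-- A matrix all of whose nonzero entries `(a, b)`, `(a', b')` with `a < a'` have `b ≤ b'`, that
is, the matrix of a set of pairwise noncrossing weighted arcs. -/
def Noncrossing {α β R : Type*} [Preorder α] [Preorder β] [Zero R] (M : Matrix α β R) : Prop :=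
  ∀ a a' b b', a < a' → M a b ≠ 0 → M a' b' ≠ 0 → b ≤ b'

/-- Only the identity contributes to the Leibniz sum: at an inversion of `σ` the two entries would
be crossing arcs, so one of them is zero. -/
theorem Noncrossing.det_submatrix {α β R : Type*} [Preorder α] [Preorder β] [CommRing R]
    {M : Matrix α β R} (hM : Noncrossing M) {k : ℕ} (f : DecSeq k α) (g : DecSeq k β) :
    (M.submatrix f.1 g.1).det = ∏ m, M (f.1 m) (g.1 m) := by
  rw [Matrix.det_apply']
  rw [Finset.sum_eq_single 1]
  · simp
  · intro σ _ hσ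
    have : ∃ a b, a < b ∧ σ b < σ a := by
      by_contra! h
      apply hσ
      have hmono : StrictMono σ := fun a b hab =>
        lt_of_le_of_ne (h a b hab) fun e => hab.ne (σ.injective e)
      ext x
      rw [(StrictMono.range_inj hmono strictMono_id).1 (by simp [σ.surjective.range_eq])]
      rfl
    obtain ⟨a, b, hab, hs⟩ := this
    have h0 : M (f.1 (σ a)) (g.1 a) = 0 ∨ M (f.1 (σ b)) (g.1 b) = 0 := by
      by_contra! h
      exact absurd (hM _ _ _ _ (f.2 hs) h.1 h.2) (not_le_of_gt (g.2 hab))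
    have : ∏ i, M.submatrix f.1 g.1 (σ i) i = 0 := by
      rcases h0 with h0 | h0
      · exact Finset.prod_eq_zero (Finset.mem_univ a) h0
      · exact Finset.prod_eq_zero (Finset.mem_univ b) h0
    rw [this, mul_zero]
  · simp

/-- Peels one set of noncrossing arcs off a network; iterated, it takes the place of the
Lindström–Gessel–Viennot lemma. -/
theorem Noncrossing.det_mul {γ β R : Type*} [LinearOrder γ] [Fintype γ] [Preorder β] [CommRing R]
    {M : Matrix γ β R} (hM : Noncrossing M) {k : ℕ} (A : Matrix (Fin k) γ R) (f : DecSeq k β) :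
    ((A * M).submatrix id f.1).det =
      ∑ g : DecSeq k γ, (A.submatrix id g.1).det * ∏ m, M (g.1 m) (f.1 m) := by
  have : (A * M).submatrix id f.1 = A * M.submatrix id f.1 := rfl
  rw [this, det_mul_eq_sum_decSeq]
  exact Finset.sum_congr rfl fun g _ => by rw [← hM.det_submatrix g f]; rfl

/-! ### Factorization of the Hankel matrix -/

/-- The coefficients `∑_j (m choose j) (m choose j + k) q^j`, where `k = 0` gives the Narayana
polynomials of type `B`. -/
noncomputable def narayanaCoeff (m k : ℕ) : ℝ[X] :=
  ∑ j ∈ Finset.range (m + 1), C ((m.choose j : ℝ) * m.choose (j + k)) * X ^ j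

theorem narayanaCoeff_zero_right (m : ℕ) : narayanaCoeff m 0 = narayana m := by
  simp [narayanaCoeff, narayana, sq]

theorem narayanaCoeff_zero_left (k : ℕ) : narayanaCoeff 0 k = if k = 0 then 1 else 0 := by
  cases k <;> simp [narayanaCoeff]

theorem narayanaCoeff_eq_zero {m k : ℕ} (h : m < k) : narayanaCoeff m k = 0 :=
  Finset.sum_eq_zero fun j _ => by
    rw [Nat.choose_eq_zero_of_lt (show m < j + k by omega)]
    simp

theorem narayanaCoeff_eq_sum_range {m N : ℕ} (k : ℕ) (h : m < N) :
    narayanaCoeff m k =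
      ∑ j ∈ Finset.range N, C ((m.choose j : ℝ) * m.choose (j + k)) * X ^ j := by
  refine Finset.sum_subset (Finset.range_subset_range.2 h) fun j _ hj => ?_
  rw [Finset.mem_range, not_lt] at hj
  rw [Nat.choose_eq_zero_of_lt (show m < j by omega)]
  simp

/-- The summand `j = m` is zero; keeping it gives the index range left in `narayanaCoeff (m + 1)`
once its constant term is split off. -/
theorem narayanaCoeff_eq_sum_succ (m k : ℕ) :
    narayanaCoeff m k = ∑ j ∈ Finset.range (m + 1),
      C ((m.choose (j + 1) : ℝ) * m.choose (j + 1 + k)) * X ^ (j + 1) +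
        C ((m.choose 0 : ℝ) * m.choose (0 + k)) * X ^ 0 := by
  rw [narayanaCoeff_eq_sum_range k (show m < m + 2 by omega), Finset.sum_range_succ']

/-- Pascal's rule for both binomials: the four resulting products are the four terms on the right.
-/
theorem narayanaCoeff_succ_succ (m k : ℕ) :
    narayanaCoeff (m + 1) (k + 1) = narayanaCoeff m k + (1 + X) * narayanaCoeff m (k + 1) +
      X * narayanaCoeff m (k + 2) := by
  rw [narayanaCoeff, Finset.sum_range_succ', narayanaCoeff_eq_sum_succ m k, add_mul, one_mul]
  nth_rw 1 [narayanaCoeff_eq_sum_succ m (k + 1)]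
  rw [narayanaCoeff, narayanaCoeff, Finset.mul_sum, Finset.mul_sum]
  have : ∀ j, (C (((m + 1).choose (j + 1) : ℝ) * (m + 1).choose (j + 1 + (k + 1))) *
      X ^ (j + 1) : ℝ[X]) = C ((m.choose (j + 1) : ℝ) * m.choose (j + 1 + k)) * X ^ (j + 1) +
        C ((m.choose (j + 1) : ℝ) * m.choose (j + 1 + (k + 1))) * X ^ (j + 1) +
        X * (C ((m.choose j : ℝ) * m.choose (j + (k + 1))) * X ^ j) +
        X * (C ((m.choose j : ℝ) * m.choose (j + (k + 2))) * X ^ j) := by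
    intro j
    rw [show j + 1 + (k + 1) = (j + k + 1) + 1 by ring, Nat.choose_succ_succ' m j,
      Nat.choose_succ_succ' m (j + k + 1), show j + 1 + k = j + k + 1 by ring,
      show j + (k + 1) = j + k + 1 by ring, show j + (k + 2) = j + k + 2 by ring]
    push_cast
    simp only [map_mul, map_add, pow_succ]
    ring
  rw [Finset.sum_congr rfl fun j _ => this j]
  simp only [Finset.sum_add_distrib]
  have h0 : (C (((m + 1).choose 0 : ℝ) * (m + 1).choose (0 + (k + 1))) * X ^ 0 : ℝ[X]) =
      C ((m.choose 0 : ℝ) * m.choose (0 + k)) * X ^ 0 +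
      C ((m.choose 0 : ℝ) * m.choose (0 + (k + 1))) * X ^ 0 := by
    rw [zero_add, Nat.choose_succ_succ' m k, zero_add]
    push_cast
    simp [map_add]
  rw [h0]
  ring

/-- Here the two mixed products of Pascal's rule coincide, which is the origin of the factor `2`. -/
theorem narayanaCoeff_succ_zero (m : ℕ) :
    narayanaCoeff (m + 1) 0 = (1 + X) * narayanaCoeff m 0 + 2 * X * narayanaCoeff m 1 := by
  rw [narayanaCoeff, Finset.sum_range_succ', add_mul, one_mul]
  nth_rw 1 [narayanaCoeff_eq_sum_succ m 0]
  rw [narayanaCoeff, narayanaCoeff, Finset.mul_sum, Finset.mul_sum]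
  have : ∀ j, (C (((m + 1).choose (j + 1) : ℝ) * (m + 1).choose (j + 1 + 0)) *
      X ^ (j + 1) : ℝ[X]) = C ((m.choose (j + 1) : ℝ) * m.choose (j + 1 + 0)) * X ^ (j + 1) +
        X * (C ((m.choose j : ℝ) * m.choose (j + 0)) * X ^ j) +
        2 * X * (C ((m.choose j : ℝ) * m.choose (j + 1)) * X ^ j) := by
    intro j
    rw [add_zero, add_zero, Nat.choose_succ_succ' m j]
    push_cast
    simp only [map_mul, map_add, pow_succ]
    ring
  rw [Finset.sum_congr rfl fun j _ => this j]
  simp only [Finset.sum_add_distrib]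
  simp
  ring

theorem tEntry_zero : tEntry 0 = 1 := if_pos rfl

theorem tEntry_one : tEntry 1 = 2 * X := by simp [tEntry]

theorem tEntry_succ_succ (k : ℕ) : tEntry (k + 2) = X * tEntry (k + 1) := by
  simp [tEntry, pow_succ]
  ring

/-- The bilinear form of the matrix `T` on the rows of the matrix of `narayanaCoeff`. -/
theorem sum_tEntry_succ_left (m l N : ℕ) (hl : l ≤ N) :
    ∑ k ∈ Finset.range (N + 1), narayanaCoeff (m + 1) k * tEntry k * narayanaCoeff l k =
      (1 + X) * ∑ k ∈ Finset.range (N + 1), narayanaCoeff m k * tEntry k * narayanaCoeff l k +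
      ∑ k ∈ Finset.range (N + 1), tEntry (k + 1) * (narayanaCoeff m k * narayanaCoeff l (k + 1) +
        narayanaCoeff m (k + 1) * narayanaCoeff l k) := by
  -- The index shift leaves one term at the upper end of the range; `l ≤ N` kills it.
  have hz : narayanaCoeff l (N + 1) = 0 := narayanaCoeff_eq_zero (by omega)
  have h1 : ∑ k ∈ Finset.range (N + 1), tEntry (k + 1) * (narayanaCoeff m k *
      narayanaCoeff l (k + 1)) =
      ∑ k ∈ Finset.range N, tEntry (k + 1) * (narayanaCoeff m k * narayanaCoeff l (k + 1)) := by
    rw [Finset.sum_range_succ, hz]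
    simp
  simp only [mul_add, Finset.sum_add_distrib]
  rw [h1]
  rw [Finset.sum_range_succ', Finset.sum_range_succ' (fun k => narayanaCoeff m k * tEntry k *
    narayanaCoeff l k), Finset.sum_range_succ' (fun k => tEntry (k + 1) *
    (narayanaCoeff m (k + 1) * narayanaCoeff l k)), narayanaCoeff_succ_zero, tEntry_zero,
    zero_add, tEntry_one]
  -- The factor `X` of the recurrence is absorbed into `tEntry`, which makes the result symmetric in
  -- `m` and `l`.
  have : ∀ k, narayanaCoeff (m + 1) (k + 1) * tEntry (k + 1) * narayanaCoeff l (k + 1) =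
      (1 + X) * (narayanaCoeff m (k + 1) * tEntry (k + 1) * narayanaCoeff l (k + 1)) +
      tEntry (k + 1) * (narayanaCoeff m k * narayanaCoeff l (k + 1)) +
      tEntry (k + 1 + 1) * (narayanaCoeff m (k + 1 + 1) * narayanaCoeff l (k + 1)) := by
    intro k
    rw [narayanaCoeff_succ_succ, tEntry_succ_succ]
    ring
  rw [Finset.sum_congr rfl fun k _ => this k]
  simp only [Finset.sum_add_distrib, ← Finset.mul_sum]
  ring

/-- By the symmetry in `sum_tEntry_succ_left`, raising `m` by one has the same effect as raising `l`
by one; so `m` can be reduced to `0`, where only `k = 0` survives. -/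
theorem sum_tEntry_eq_narayana (m l N : ℕ) (hm : m + l ≤ N) :
    ∑ k ∈ Finset.range (N + 1), narayanaCoeff m k * tEntry k * narayanaCoeff l k =
      narayana (m + l) := by
  induction m generalizing l with
  | zero =>
    rw [Finset.sum_range_succ', Finset.sum_eq_zero]
    · rw [narayanaCoeff_zero_left, tEntry_zero, narayanaCoeff_zero_right]
      simp
    · simp [narayanaCoeff_zero_left]
  | succ m ih =>
    rw [show m + 1 + l = m + (l + 1) by ring, ← ih (l + 1) (by omega),
      sum_tEntry_succ_left m l N (by omega)]
    have h : ∀ k, narayanaCoeff m k * tEntry k * narayanaCoeff (l + 1) k =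
        narayanaCoeff (l + 1) k * tEntry k * narayanaCoeff m k := fun k => by ring
    rw [Finset.sum_congr rfl fun k _ => h k, sum_tEntry_succ_left l m N (by omega)]
    refine congrArg₂ (· + ·) (congrArg _ (Finset.sum_congr rfl fun k _ => ?_))
      (Finset.sum_congr rfl fun k _ => ?_)
    · ring
    · ring

theorem sum_tEntry_eq_narayana_of_le {m l n : ℕ} (hm : m ≤ n) (hl : l ≤ n) :
    ∑ k ∈ Finset.range (n + 1), narayanaCoeff m k * tEntry k * narayanaCoeff l k =
      narayana (m + l) := by
  rw [← sum_tEntry_eq_narayana m l (n + n) (by omega)]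
  refine Finset.sum_subset (Finset.range_subset_range.2 (by omega)) fun k _ hk => ?_
  rw [Finset.mem_range, not_lt] at hk
  rw [narayanaCoeff_eq_zero (show m < k by omega)]
  ring

/-! ### Steps through a layer -/

/-- The kinds of paths through a layer of `D^{B_n}`. From `P^{(i)}_x`, a path `late` goes up in its
second arc only, a path `early` in its first arc only, and a path `double` in both. Where the
second arc is one of the two parallel ones, `late` and `double` use the left one. -/
inductive Kind : Type
  | horiz | straight | late | right | early | double | doubleRight | skip
  deriving DecidableEq

namespace Kind

instance : Fintype Kind where
  elems := {horiz, straight, late, right, early, double, doubleRight, skip}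
  complete κ := by cases κ <;> decide

/-- The path of kind `κ` from `P^{(i)}_x` exists and leads to `P^{(i+1)}_y`. -/
def IsStep (n i x : ℕ) (κ : Kind) (y : ℕ) : Prop :=
  match κ with
  | horiz => i + 2 ≤ x ∧ x ≤ n ∧ y = x
  | straight => x ≤ i + 1 ∧ y = x
  | late => x ≤ i ∧ y = x + 1
  | right => x = i ∧ y = x + 1
  | early => x ≤ i ∧ y = x + 1
  | double => x + 1 ≤ i ∧ y = x + 2
  | doubleRight => x + 1 = i ∧ y = x + 2
  | skip => x = i ∧ y = x + 1

/-- The height of the path of kind `κ` from `P^{(i)}_x` in the middle of the layer: `2 j` if it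
passes through `Q^{(i)}_j`. -/
def mid (x : ℕ) : Kind → ℕ
  | horiz => 2 * x
  | straight => 2 * x
  | late => 2 * x
  | right => 2 * x
  | early => 2 * x + 2
  | double => 2 * x + 2
  | doubleRight => 2 * x + 2
  | skip => 2 * x + 1

/-- The weight of a path of kind `κ`. -/
noncomputable def weight : Kind → ℝ[X]
  | horiz => 1
  | straight => 1
  | late => 1
  | right => 1
  | early => X
  | double => X
  | doubleRight => X
  | skip => -1

theorem mid_late (x : ℕ) : late.mid x = 2 * x := rfl

theorem mid_early (x : ℕ) : early.mid x = 2 * x + 2 := rfl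

theorem mid_skip (x : ℕ) : skip.mid x = 2 * x + 1 := rfl

theorem le_mid (x : ℕ) (κ : Kind) : 2 * x ≤ κ.mid x := by
  cases κ <;> simp only [mid] <;> omega

theorem mid_le (x : ℕ) (κ : Kind) : κ.mid x ≤ 2 * x + 2 := by
  cases κ <;> simp only [mid] <;> omega

/-- Heights lie in `[2x, 2x + 2]`, so in the first half of a layer two paths can meet but not cross.
-/
theorem IsStep.mid_lt_of_ne {n i x y x' y' : ℕ} {κ κ' : Kind} (_ : IsStep n i x κ y)
    (_ : IsStep n i x' κ' y') (hx : x' < x) (hm : κ'.mid x' ≠ κ.mid x) :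
    κ'.mid x' < κ.mid x := by
  have := le_mid x κ
  have := mid_le x' κ'
  omega

theorem IsStep.le_of_mid_lt {n i x y x' y' : ℕ} {κ κ' : Kind} (h : IsStep n i x κ y)
    (h' : IsStep n i x' κ' y') (hm : κ'.mid x' < κ.mid x) : y' ≤ y := by
  cases κ <;> cases κ' <;> simp only [IsStep, mid] at h h' hm <;> omega

end Kind

/-- The families of disjoint paths through the `i`-th layer from the vertices in `g` to those in
`f`. -/
@[ext]
structure LayerFam (n i : ℕ) {k : ℕ} (g f : Fin k → ℕ) : Type where
  kind : Fin k → Kind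
  isStep : ∀ m, (kind m).IsStep n i (g m) (f m)
  mid : StrictAnti fun m => (kind m).mid (g m)

theorem LayerFam.kind_injective {n i k : ℕ} {g f : Fin k → ℕ} :
    Function.Injective (LayerFam.kind : LayerFam n i g f → Fin k → Kind) :=
  fun _ _ => LayerFam.ext

instance (n i : ℕ) {k : ℕ} (g f : Fin k → ℕ) : Finite (LayerFam n i g f) :=
  Finite.of_injective _ LayerFam.kind_injective

noncomputable instance (n i : ℕ) {k : ℕ} (g f : Fin k → ℕ) : Fintype (LayerFam n i g f) :=
  Fintype.ofFinite _

/-- The weight of a family of paths through a layer. -/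
noncomputable def LayerFam.weight {n i k : ℕ} {g f : Fin k → ℕ} (ℓ : LayerFam n i g f) : ℝ[X] :=
  ∏ m, (ℓ.kind m).weight

/-! ### The matrix of a layer -/

/-- The arcs in the first half of the `i`-th layer. -/
noncomputable def firstHalf (n i : ℕ) : Matrix (Fin (n + 1)) (Fin (2 * n + 4)) ℝ[X] :=
  Matrix.of fun x c => if (c : ℕ) = 2 * x then 1 else if (c : ℕ) = 2 * x + 2 ∧ (x : ℕ) ≤ i then X
    else if (c : ℕ) = 2 * x + 1 ∧ (x : ℕ) = i then -1 else 0

/-- The arcs in the second half of the `i`-th layer. -/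
noncomputable def secondHalf (n i : ℕ) : Matrix (Fin (2 * n + 4)) (Fin (n + 1)) ℝ[X] :=
  Matrix.of fun c y => if (c : ℕ) = 2 * y then 1 else if (c : ℕ) + 2 = 2 * y ∧ (y : ℕ) ≤ i then 1
    else if (c : ℕ) + 2 = 2 * y ∧ (y : ℕ) = i + 1 then 2
    else if (c : ℕ) = 2 * i + 1 ∧ (y : ℕ) = i + 1 then 1 else 0

/-- The matrix of the `i`-th layer. -/
noncomputable def layerMatrix (n i : ℕ) : Matrix (Fin (n + 1)) (Fin (n + 1)) ℝ[X] :=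
  firstHalf n i * secondHalf n i

/-- The cut in the middle is essential: for `1 ≤ i`, `layerMatrix n i` itself has crossing entries,
since a double rise from `x` passes a straight path from `x + 1`. -/
theorem noncrossing_firstHalf (n i : ℕ) : Noncrossing (firstHalf n i) := by
  intro a a' b b' h h1 h2
  simp only [firstHalf, Matrix.of_apply] at h1 h2
  rw [Fin.lt_def] at h
  rw [Fin.le_def]
  split_ifs at h1 h2 <;> first | omega | exact absurd rfl h1 | exact absurd rfl h2

theorem noncrossing_secondHalf (n i : ℕ) : Noncrossing (secondHalf n i) := by
  intro a a' b b' h h1 h2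
  simp only [secondHalf, Matrix.of_apply] at h1 h2
  rw [Fin.lt_def] at h
  rw [Fin.le_def]
  split_ifs at h1 h2 <;> first | omega | exact absurd rfl h1 | exact absurd rfl h2

theorem Kind.sum_eq (F : Kind → ℝ[X]) : ∑ κ, F κ = F horiz + F straight + F late + F right +
    F early + F double + F doubleRight + F skip := by
  have : (Finset.univ : Finset Kind) =
    {horiz, straight, late, right, early, double, doubleRight, skip} := rfl
  rw [this]
  simp
  ring

-- The columns `c` are heights. The negative arc has no vertex `Q`, so it gets the artificial odd
-- height `2i + 1`. The entry `2` of `secondHalf` stands for the parallel arcs, hence for `late`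
-- with `right` or `double` with `doubleRight`.
open Classical in
theorem firstHalf_mul_secondHalf {n i : ℕ} (hi : i < n) (x y : Fin (n + 1))
    (c : Fin (2 * n + 4)) :
    firstHalf n i x c * secondHalf n i c y =
      ∑ κ : Kind, if κ.IsStep n i x y ∧ κ.mid x = c then κ.weight else 0 := by
  obtain ⟨x, hx⟩ := x
  obtain ⟨y, hy⟩ := y
  obtain ⟨c, hc⟩ := c
  rw [Kind.sum_eq]
  simp only [firstHalf, secondHalf, Matrix.of_apply, Kind.IsStep, Kind.mid, Kind.weight]
  by_cases h1 : c = 2 * x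
  · subst h1
    have e1 : ∀ p : Prop, ¬ (p ∧ 2 * x + 2 = 2 * x) := by omega
    have e2 : ∀ p : Prop, ¬ (p ∧ 2 * x + 1 = 2 * x) := by omega
    simp only [e1, e2, if_false, if_true, and_true, one_mul, add_zero]
    split_ifs <;> first | omega | norm_num
  have e1 : ∀ p : Prop, ¬ (p ∧ 2 * x = c) := by omega
  simp only [e1, h1, if_false, zero_add]
  by_cases h2 : c = 2 * x + 2
  · subst h2
    have e2 : ∀ p : Prop, ¬ (p ∧ 2 * x + 1 = 2 * x + 2) := by omega
    have e3 : ∀ p : Prop, ¬ (2 * x + 2 = 2 * x + 1 ∧ p) := by omega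
    simp only [e2, e3, if_false, true_and, and_true, add_zero]
    split_ifs <;> first | omega | ring
  have e2 : ∀ p : Prop, ¬ (p ∧ 2 * x + 2 = c) := by omega
  simp only [e2, h2, false_and, if_false, zero_add]
  by_cases h3 : c = 2 * x + 1
  · subst h3
    simp only [true_and, and_true]
    split_ifs <;> first | omega | ring
  have e3 : ∀ p : Prop, ¬ (p ∧ 2 * x + 1 = c) := by omega
  simp only [e3, h3, false_and, if_false, zero_mul]

open Classical in
theorem layerMatrix_apply {n i : ℕ} (hi : i < n) (x y : Fin (n + 1)) :
    layerMatrix n i x y = ∑ κ : Kind, if κ.IsStep n i x y then κ.weight else 0 := by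
  rw [layerMatrix, Matrix.mul_apply, Finset.sum_congr rfl fun c _ =>
    firstHalf_mul_secondHalf hi x y c, Finset.sum_comm]
  refine Finset.sum_congr rfl fun κ _ => ?_
  have hc : κ.mid x < 2 * n + 4 := by
    have := κ.mid_le x
    omega
  rw [Finset.sum_eq_single ⟨κ.mid x, hc⟩]
  · simp
  · intro c _ hne
    rw [if_neg]
    rintro ⟨-, h⟩
    exact hne (Fin.ext h.symm)
  · simp

/-- The positions of a decreasing sequence of vertices, as natural numbers. -/
abbrev DecSeq.pos {n k : ℕ} (g : DecSeq k (Fin (n + 1))) : Fin k → ℕ := fun m => (g.1 m : ℕ)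

/-- The kinds determine the heights, so each choice of kinds occurs for at most one `h`, and for one
exactly when the heights decrease. -/
theorem sum_layerFam_weight {n i k : ℕ} (hi : i < n) (g f : DecSeq k (Fin (n + 1))) :
    ∑ ℓ : LayerFam n i g.pos f.pos, ℓ.weight =
      ∑ h : DecSeq k (Fin (2 * n + 4)),
        ∏ m, firstHalf n i (g.1 m) (h.1 m) * secondHalf n i (h.1 m) (f.1 m) := by
  classical
  have h1 : ∀ h : DecSeq k (Fin (2 * n + 4)),
      ∏ m, firstHalf n i (g.1 m) (h.1 m) * secondHalf n i (h.1 m) (f.1 m) =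
      ∑ κ : Fin k → Kind, if ∀ m, (κ m).IsStep n i (g.1 m) (f.1 m) ∧ (κ m).mid (g.1 m) = h.1 m
        then ∏ m, (κ m).weight else 0 := by
    intro h
    rw [Finset.prod_congr rfl fun m _ => firstHalf_mul_secondHalf hi _ _ _,
      Finset.prod_univ_sum, Fintype.piFinset_univ]
    exact Finset.sum_congr rfl fun κ _ => by rw [Finset.prod_ite_zero]; simp
  rw [Finset.sum_congr rfl fun h _ => h1 h, Finset.sum_comm]
  symm
  refine (Fintype.sum_of_injective (fun ℓ : LayerFam n i g.pos f.pos => ℓ.kind)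
    LayerFam.kind_injective _ _ (fun κ hκ => ?_) (fun ℓ => ?_)).symm
  · refine Finset.sum_eq_zero fun h _ => if_neg fun hh => hκ ⟨⟨κ, fun m => (hh m).1, ?_⟩, rfl⟩
    intro a b hab
    simp only [(hh _).2]
    exact h.2 hab
  · have hc : ∀ m, (ℓ.kind m).mid (g.1 m) < 2 * n + 4 := fun m => by
      have := (ℓ.kind m).mid_le (g.1 m)
      omega
    rw [Finset.sum_eq_single ⟨fun m => ⟨_, hc m⟩, ℓ.mid⟩]
    · rw [if_pos fun m => ⟨ℓ.isStep m, rfl⟩]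
      rfl
    · intro h _ hne
      rw [if_neg]
      intro hh
      exact hne (Subtype.ext (funext fun m => Fin.ext (hh m).2.symm))
    · simp

/-- The determinantal form of one step of the transfer through the layers. -/
theorem det_mul_layerMatrix {n i k : ℕ} (hi : i < n) (A : Matrix (Fin k) (Fin (n + 1)) ℝ[X])
    (f : DecSeq k (Fin (n + 1))) :
    ((A * layerMatrix n i).submatrix id f.1).det =
      ∑ g : DecSeq k (Fin (n + 1)), (A.submatrix id g.1).det *
        ∑ ℓ : LayerFam n i g.pos f.pos, ℓ.weight := by
  rw [layerMatrix, ← Matrix.mul_assoc, (noncrossing_secondHalf n i).det_mul]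
  simp only [(noncrossing_firstHalf n i).det_mul, sum_layerFam_weight hi, Finset.sum_mul,
    Finset.mul_sum, Finset.prod_mul_distrib]
  rw [Finset.sum_comm]
  exact Finset.sum_congr rfl fun g _ => Finset.sum_congr rfl fun h _ => by ring

/-! ### The matrix of the network -/

/-- From `i` to `i + 1` the weights are `1, 1, q, -1`: the negative arc restores the generic `1 +
q`, while the double rise to `i + 1` keeps its `2q`. -/
theorem layerMatrix_apply_eq {n i : ℕ} (hi : i < n) (x y : Fin (n + 1)) :
    layerMatrix n i x y = (if (x : ℕ) = y then 1 else 0) +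
      (if (x : ℕ) + 1 = y ∧ (x : ℕ) ≤ i then 1 + X else 0) +
      (if (x : ℕ) + 2 = y ∧ (x : ℕ) + 1 ≤ i then (if (x : ℕ) + 1 = i then 2 * X else X)
        else 0) := by
  classical
  obtain ⟨x, hx⟩ := x
  obtain ⟨y, hy⟩ := y
  rw [layerMatrix_apply hi, Kind.sum_eq]
  simp only [Kind.IsStep, Kind.weight]
  by_cases h1 : x = y
  · subst h1
    simp only [left_eq_add, one_ne_zero, and_false, Nat.add_eq_left, false_and, if_false,
      if_true, and_true, OfNat.ofNat_ne_zero]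
    split_ifs <;> first | omega | norm_num
  have e1 : ∀ p : Prop, ¬ (p ∧ y = x) := by omega
  simp only [h1, e1, and_false, if_false, zero_add]
  by_cases h2 : x + 1 = y
  · subst h2
    have e2 : ∀ p : Prop, ¬ (p ∧ x + 1 = x + 2) := by omega
    have e3 : ∀ p : Prop, ¬ (x + 2 = x + 1 ∧ p) := by omega
    simp only [e2, e3, if_false, true_and, and_true, add_zero]
    split_ifs <;> first | omega | ring1
  have e2 : ∀ p : Prop, ¬ (p ∧ y = x + 1) := by omega
  have e3 : ∀ p : Prop, ¬ (x + 1 = y ∧ p) := by omega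
  simp only [e2, e3, if_false, zero_add, add_zero]
  by_cases h3 : x + 2 = y
  · subst h3
    simp only [true_and, and_true]
    split_ifs <;> first | omega | ring1
  have e2 : ∀ p : Prop, ¬ (p ∧ y = x + 2) := by omega
  have e3 : ∀ p : Prop, ¬ (x + 2 = y ∧ p) := by omega
  simp only [e2, e3, if_false, add_zero]

/-- The matrix of the first `i` layers. -/
noncomputable def networkMatrix (n : ℕ) : ℕ → Matrix (Fin (n + 1)) (Fin (n + 1)) ℝ[X]
  | 0 => 1
  | i + 1 => networkMatrix n i * layerMatrix n i

/-- The entries of the matrix of the first `i` layers. -/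
noncomputable def networkEntry (i x y : ℕ) : ℝ[X] :=
  if y ≤ i then (if x ≤ i then narayanaCoeff (i - x) (i - y) else 0) else if x = y then 1 else 0

/-- This is the recurrence of `narayanaCoeff` in reversed coordinates: with `k = i + 1 - y`, the
positions `y`, `y - 1`, `y - 2` before the layer have indices `k - 1`, `k`, `k + 1`. The boundary
case `k = 0` is `y = i + 1`. -/
theorem networkEntry_succ (i x y : ℕ) : networkEntry (i + 1) x y = networkEntry i x y +
      (if 1 ≤ y ∧ y ≤ i + 1 then networkEntry i x (y - 1) * (1 + X) else 0) +
      (if 2 ≤ y ∧ y ≤ i + 1 then networkEntry i x (y - 2) * (if y = i + 1 then 2 * X else X)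
        else 0) := by
  rcases lt_or_ge (i + 1) y with hy | hy
  · simp [networkEntry, hy.not_ge, (show ¬ y ≤ i by omega)]
  rcases lt_or_ge (i + 1) x with hx | hx
  · simp only [networkEntry]
    split_ifs <;> first | omega | simp
  have hz : ∀ z, z ≤ i → i < x → networkEntry i x z = 0 := fun z hz hx => by
    rw [networkEntry, if_pos hz, if_neg (by omega)]
  rcases eq_or_lt_of_le hx with rfl | hx
  · have h1 : networkEntry (i + 1) (i + 1) y = if i + 1 = y then 1 else 0 := by
      rw [networkEntry, if_pos hy, if_pos le_rfl, Nat.sub_self, narayanaCoeff_zero_left]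
      exact if_congr (by omega) rfl rfl
    have h2 : networkEntry i (i + 1) y = if i + 1 = y then 1 else 0 := by
      split_ifs with h
      · rw [networkEntry, if_neg (by omega), if_pos h]
      · exact hz _ (by omega) (by omega)
    rw [h1, h2, hz (y - 1) (by omega) (by omega), hz (y - 2) (by omega) (by omega)]
    simp
  obtain ⟨m, rfl⟩ := Nat.exists_eq_add_of_le (Nat.lt_succ_iff.1 hx)
  rcases eq_or_lt_of_le hy with rfl | hy
  · rcases Nat.eq_zero_or_pos (x + m) with h0 | h0
    -- Here `y = 1`, and the guard `2 ≤ y` discards the truncated position `y - 2`.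
    · obtain ⟨rfl, rfl⟩ : x = 0 ∧ m = 0 := by omega
      have e1 : networkEntry 1 0 1 = 1 + X := by
        simp [networkEntry, narayanaCoeff_succ_zero, narayanaCoeff_zero_left]
      have e2 : networkEntry 0 0 1 = 0 := by simp [networkEntry]
      have e3 : networkEntry 0 0 0 = 1 := by simp [networkEntry, narayanaCoeff_zero_left]
      simp [e1, e2, e3]
    · have e1 : x + m + 1 - x = m + 1 := by omega
      have e2 : x + m - x = m := by omega
      have h1 : networkEntry (x + m) x (x + m + 1) = 0 := by
        rw [networkEntry, if_neg (by omega), if_neg (by omega)]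
      have h2 : networkEntry (x + m) x (x + m + 1 - 1) = narayanaCoeff m 0 := by
        rw [networkEntry, if_pos (by omega), if_pos (by omega), e2,
          show x + m - (x + m + 1 - 1) = 0 by omega]
      have h3 : networkEntry (x + m) x (x + m + 1 - 2) = narayanaCoeff m 1 := by
        rw [networkEntry, if_pos (by omega), if_pos (by omega), e2,
          show x + m - (x + m + 1 - 2) = 1 by omega]
      rw [h1, h2, h3, if_pos (by omega), if_pos (by omega), if_pos rfl, networkEntry,
        if_pos le_rfl, if_pos (by omega), e1, Nat.sub_self, narayanaCoeff_succ_zero]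
      ring
  · have e1 : x + m + 1 - x = m + 1 := by omega
    have e2 : x + m - x = m := by omega
    obtain ⟨k, hk⟩ := Nat.exists_eq_add_of_le (Nat.lt_succ_iff.1 hy)
    have e3 : x + m + 1 - y = k + 1 := by omega
    have e4 : x + m - y = k := by omega
    have h1 : networkEntry (x + m) x y = narayanaCoeff m k := by
      rw [networkEntry, if_pos (by omega), if_pos (by omega), e2, e4]
    have h2 : (if 1 ≤ y ∧ y ≤ x + m + 1 then networkEntry (x + m) x (y - 1) * (1 + X) else 0) =
        narayanaCoeff m (k + 1) * (1 + X) := by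
      split_ifs with h
      · rw [networkEntry, if_pos (by omega), if_pos (by omega), e2,
          show x + m - (y - 1) = k + 1 by omega]
      -- There is no position `y - 1` for `y = 0`, but then `k + 1 > m` and the recurrence has no
      -- such term either.
      · rw [narayanaCoeff_eq_zero (by omega), zero_mul]
    have h3 : (if 2 ≤ y ∧ y ≤ x + m + 1 then networkEntry (x + m) x (y - 2) *
        (if y = x + m + 1 then 2 * X else X) else 0) = narayanaCoeff m (k + 2) * X := by
      rw [if_neg (show ¬ y = x + m + 1 by omega)]
      split_ifs with h
      · rw [networkEntry, if_pos (by omega), if_pos (by omega), e2,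
          show x + m - (y - 2) = k + 2 by omega]
      · rw [narayanaCoeff_eq_zero (by omega), zero_mul]
    rw [h1, h2, h3, networkEntry, if_pos (by omega), if_pos (by omega), e1, e3,
      narayanaCoeff_succ_succ]
    ring

theorem networkMatrix_apply {n i : ℕ} (hi : i ≤ n) (x y : Fin (n + 1)) :
    networkMatrix n i x y = networkEntry i x y := by
  induction i generalizing y with
  | zero =>
    obtain ⟨x, hx⟩ := x
    obtain ⟨y, hy⟩ := y
    simp only [networkMatrix, networkEntry, Matrix.one_apply, Fin.mk.injEq, Nat.zero_sub,
      narayanaCoeff_zero_left]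
    split_ifs <;> first | omega | rfl
  | succ i ih =>
    obtain ⟨y, hy⟩ := y
    rw [networkMatrix, Matrix.mul_apply, Finset.sum_congr rfl fun z _ => by
      rw [ih (by omega), layerMatrix_apply_eq (by omega), mul_add, mul_add], networkEntry_succ]
    simp only [Finset.sum_add_distrib]
    refine congrArg₂ (· + ·) (congrArg₂ (· + ·) ?_ ?_) ?_
    · rw [Finset.sum_eq_single ⟨y, hy⟩]
      · simp
      · intro z _ hz
        rw [if_neg fun h => hz (Fin.ext h), mul_zero]
      · simp
    · split_ifs with h
      · rw [Finset.sum_eq_single ⟨y - 1, by omega⟩]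
        · rw [if_pos (by constructor <;> simp only <;> omega)]
        · intro z _ hz
          rw [if_neg fun h => hz (Fin.ext (by simp only at h ⊢; omega)), mul_zero]
        · simp
      · refine Finset.sum_eq_zero fun z _ => ?_
        rw [if_neg (by omega), mul_zero]
    · by_cases h : 2 ≤ y ∧ y ≤ i + 1
      · rw [if_pos h, Finset.sum_eq_single ⟨y - 2, by omega⟩]
        · rw [if_pos (by constructor <;> simp only <;> omega)]
          exact congrArg _ (if_congr (by simp only; omega) rfl rfl)
        · intro z _ hz
          rw [if_neg fun h => hz (Fin.ext (by simp only at h ⊢; omega)), mul_zero]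
        · simp
      · rw [if_neg h]
        refine Finset.sum_eq_zero fun z _ => ?_
        rw [if_neg (by omega), mul_zero]

/-- The factorization `H_n = B_n T_n B_n^t`, in terms of positions in the network. -/
theorem hankelTrunc_rev_eq (n : ℕ) : (hankelTrunc n).submatrix Fin.rev Fin.rev =
    networkMatrix n n * (Matrix.diagonal (fun y : Fin (n + 1) => tEntry (n - y)) *
      (networkMatrix n n).transpose) := by
  ext1 a b
  have h : ∀ x y : Fin (n + 1), networkMatrix n n x y = narayanaCoeff (n - x) (n - y) := by
    intro x y
    rw [networkMatrix_apply le_rfl, networkEntry, if_pos (by omega), if_pos (by omega)]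
  rw [Matrix.mul_apply]
  simp only [Matrix.diagonal_mul, Matrix.transpose_apply, h, Matrix.submatrix_apply, hankelTrunc,
    Matrix.of_apply, Fin.val_rev]
  rw [show n + 1 - (a + 1 : ℕ) = n - a by omega, show n + 1 - (b + 1 : ℕ) = n - b by omega,
    ← sum_tEntry_eq_narayana_of_le (Nat.sub_le n a) (Nat.sub_le n b), ← Finset.sum_range_reflect,
    ← Fin.sum_univ_eq_sum_range]
  refine Finset.sum_congr rfl fun y _ => ?_
  rw [show n + 1 - 1 - (y : ℕ) = n - y by omega, mul_assoc]

/-- A decreasing sequence of positions in the network for an increasing sequence of rows. -/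
def revSeq {n k : ℕ} {I : Fin k → Fin (n + 1)} (hI : StrictMono I) : DecSeq k (Fin (n + 1)) :=
  ⟨fun m => ⟨n - I m, by omega⟩, fun a b h => by
    have := hI h
    rw [Fin.lt_def] at this ⊢
    simp only
    omega⟩

theorem rev_revSeq {n k : ℕ} {I : Fin k → Fin (n + 1)} (hI : StrictMono I) (m : Fin k) :
    ((revSeq hI).1 m).rev = I m := by
  ext
  rw [Fin.val_rev, revSeq]
  simp only
  omega

/-- Cauchy–Binet at the middle segment: `f` records the positions in which the paths traverse it. -/
theorem det_hankelTrunc_submatrix {n k : ℕ} {I J : Fin k → Fin (n + 1)} (hI : StrictMono I)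
    (hJ : StrictMono J) : ((hankelTrunc n).submatrix I J).det =
      ∑ f : DecSeq k (Fin (n + 1)), ((networkMatrix n n).submatrix (revSeq hI).1 f.1).det *
        ((∏ m, tEntry (n - f.pos m)) *
          ((networkMatrix n n).submatrix (revSeq hJ).1 f.1).det) := by
  have h : (hankelTrunc n).submatrix I J = (networkMatrix n n).submatrix (revSeq hI).1 id *
      (Matrix.diagonal (fun y : Fin (n + 1) => tEntry (n - y)) *
      (networkMatrix n n).transpose).submatrix id (revSeq hJ).1 := by
    have e := congrArg (fun M => M.submatrix (revSeq hI).1 (revSeq hJ).1) (hankelTrunc_rev_eq n)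
    simp only [Matrix.submatrix_submatrix] at e
    rw [Matrix.submatrix_mul _ _ _ id _ Function.bijective_id] at e
    rw [← e]
    congr 1 <;> ext m <;> simp [rev_revSeq]
  rw [h, det_mul_eq_sum_decSeq]
  refine Finset.sum_congr rfl fun f _ => ?_
  have h2 : (Matrix.submatrix ((Matrix.diagonal (fun y : Fin (n + 1) => tEntry (n - y)) *
      (networkMatrix n n).transpose).submatrix id (revSeq hJ).1) f.1 id) =
      Matrix.of fun a b => tEntry (n - f.pos a) *
        ((networkMatrix n n).submatrix (revSeq hJ).1 f.1).transpose a b := by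
    ext1 a b
    simp [Matrix.diagonal_mul]
  rw [h2, Matrix.det_mul_column, Matrix.det_transpose]
  rfl

/-! ### The sign-reversing involution of a layer -/

section LayerInvolution

variable {n i k : ℕ} {g f : Fin k → ℕ} {κ : Fin k → Kind} {s t : ℕ}

/-- The paths from the positions `i, i - 1, …, s + 1` are of kind `early`, that from position `s`
is of kind `late`. -/
structure LatePattern (i : ℕ) (g : Fin k → ℕ) (κ : Fin k → Kind) (s : ℕ) : Prop where
  le : s ≤ i
  early : ∀ x, s < x → x ≤ i → ∃ m, g m = x ∧ κ m = .early
  late : ∃ m, g m = s ∧ κ m = .late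

/-- The path from position `i` is of kind `skip`, and those from `i - 1, …, s` are of kind `early`,
where `s` is the least possible. -/
structure SkipPattern (i : ℕ) (g : Fin k → ℕ) (κ : Fin k → Kind) (s : ℕ) : Prop where
  le : s ≤ i
  early : ∀ x, s ≤ x → x < i → ∃ m, g m = x ∧ κ m = .early
  skip : ∃ m, g m = i ∧ κ m = .skip
  ne_early : ∀ m, g m + 1 = s → κ m ≠ .early

/-- The kinds of a skip pattern at the positions `s, …, i`. -/
def toSkip (i : ℕ) (g : Fin k → ℕ) (κ : Fin k → Kind) (s : ℕ) : Fin k → Kind := fun m =>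
  if g m = i then .skip else if s ≤ g m ∧ g m < i then .early else κ m

/-- The kinds of a late pattern at the positions `s, …, i`. -/
def toLate (i : ℕ) (g : Fin k → ℕ) (κ : Fin k → Kind) (s : ℕ) : Fin k → Kind := fun m =>
  if g m = s then .late else if s < g m ∧ g m ≤ i then .early else κ m

theorem LatePattern.apply_eq (h : LatePattern i g κ s) (hg : StrictAnti g) {m : Fin k}
    (h1 : s ≤ g m) (h2 : g m ≤ i) : κ m = if g m = s then .late else .early := by
  split_ifs with hs
  · obtain ⟨m', hm', hk⟩ := h.late
    rwa [hg.injective (hs.trans hm'.symm)]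
  · obtain ⟨m', hm', hk⟩ := h.early (g m) (by omega) h2
    rwa [hg.injective hm'] at hk

theorem SkipPattern.apply_eq (h : SkipPattern i g κ s) (hg : StrictAnti g) {m : Fin k}
    (h1 : s ≤ g m) (h2 : g m ≤ i) : κ m = if g m = i then .skip else .early := by
  split_ifs with hs
  · obtain ⟨m', hm', hk⟩ := h.skip
    rwa [hg.injective (hs.trans hm'.symm)]
  · obtain ⟨m', hm', hk⟩ := h.early (g m) h1 (by omega)
    rwa [hg.injective hm'] at hk

theorem LatePattern.occupied (h : LatePattern i g κ s) {x : ℕ} (h1 : s ≤ x) (h2 : x ≤ i) :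
    ∃ m, g m = x := by
  rcases eq_or_lt_of_le h1 with rfl | h1
  · exact h.late.imp fun _ => And.left
  · exact (h.early x h1 h2).imp fun _ => And.left

theorem SkipPattern.occupied (h : SkipPattern i g κ s) {x : ℕ} (h1 : s ≤ x) (h2 : x ≤ i) :
    ∃ m, g m = x := by
  rcases eq_or_lt_of_le h2 with rfl | h2
  · exact h.skip.imp fun _ => And.left
  · exact (h.early x h1 h2).imp fun _ => And.left

theorem LatePattern.not_lt (h : LatePattern i g κ s) (h' : LatePattern i g κ t)
    (hg : StrictAnti g) : ¬ s < t := by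
  intro hst
  obtain ⟨m, hm, hk⟩ := h'.late
  have := h.apply_eq hg (m := m) (by omega) (hm.trans_le h'.le)
  rw [hk, if_neg (by omega)] at this
  cases this

/-- `LayerFam.flip` obtains `s` by choice; uniqueness makes this harmless. -/
theorem LatePattern.unique (h : LatePattern i g κ s) (h' : LatePattern i g κ t)
    (hg : StrictAnti g) : s = t :=
  le_antisymm (Nat.not_lt.1 (h'.not_lt h hg)) (Nat.not_lt.1 (h.not_lt h' hg))

/-- The longer run would have an early path from `t - 1`, against the minimality of `t`. -/
theorem SkipPattern.not_lt (h : SkipPattern i g κ s) (h' : SkipPattern i g κ t) : ¬ s < t := by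
  intro hst
  have := h'.le
  obtain ⟨m, hm, hk⟩ := h.early (t - 1) (by omega) (by omega)
  exact h'.ne_early m (by omega) hk

theorem SkipPattern.unique (h : SkipPattern i g κ s) (h' : SkipPattern i g κ t) : s = t :=
  le_antisymm (Nat.not_lt.1 (h'.not_lt h)) (Nat.not_lt.1 (h.not_lt h'))

theorem SkipPattern.not_latePattern (h : SkipPattern i g κ s) (hg : StrictAnti g) :
    ¬ LatePattern i g κ t := by
  intro h'
  obtain ⟨m, hm, hk⟩ := h.skip
  have := h'.apply_eq hg (m := m) (hm.symm ▸ h'.le) hm.le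
  rw [hk] at this
  split_ifs at this

theorem exists_skipPattern (hm : ∃ m, g m = i ∧ κ m = .skip) : ∃ s, SkipPattern i g κ s := by
  classical
  -- The run of early paths may be empty (`s = i`); `Nat.find` extends it downwards as far as
  -- possible, which gives `ne_early`.
  have hex : ∃ s, s ≤ i ∧ ∀ x, s ≤ x → x < i → ∃ m, g m = x ∧ κ m = .early :=
    ⟨i, le_rfl, fun x h1 h2 => by omega⟩
  refine ⟨Nat.find hex, (Nat.find_spec hex).1, (Nat.find_spec hex).2, hm, fun m hgm hk => ?_⟩
  refine Nat.find_min hex (m := g m) (by omega) ⟨by have := (Nat.find_spec hex).1; omega, ?_⟩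
  intro x h1 h2
  rcases eq_or_lt_of_le h1 with rfl | h1
  · exact ⟨m, rfl, hk⟩
  · exact (Nat.find_spec hex).2 x (by omega) h2

/-- The run cannot be extended below `s`: an early path from `s - 1` would meet the late path from
`s` at height `2s`. -/
theorem LatePattern.skipPattern_toSkip (h : LatePattern i g κ s)
    (hmid : StrictAnti fun m => (κ m).mid (g m)) : SkipPattern i g (toSkip i g κ s) s := by
  refine ⟨h.le, fun x h1 h2 => ?_, ?_, fun m hm hk => ?_⟩
  · obtain ⟨m, rfl⟩ := h.occupied h1 h2.le
    exact ⟨m, rfl, by rw [toSkip, if_neg h2.ne, if_pos ⟨h1, h2⟩]⟩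
  · obtain ⟨m, hm⟩ := h.occupied h.le le_rfl
    exact ⟨m, hm, by rw [toSkip, if_pos hm]⟩
  · have hle := h.le
    rw [toSkip, if_neg (by omega), if_neg (by omega)] at hk
    obtain ⟨m', hm', hk'⟩ := h.late
    have : m = m' := hmid.injective (by simp only [hk, hk', Kind.mid]; omega)
    subst this
    omega

theorem SkipPattern.latePattern_toLate (h : SkipPattern i g κ s) :
    LatePattern i g (toLate i g κ s) s := by
  refine ⟨h.le, fun x h1 h2 => ?_, ?_⟩
  · obtain ⟨m, rfl⟩ := h.occupied h1.le h2
    exact ⟨m, rfl, by rw [toLate, if_neg h1.ne', if_pos ⟨h1, h2⟩]⟩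
  · obtain ⟨m, hm⟩ := h.occupied le_rfl h.le
    exact ⟨m, hm, by rw [toLate, if_pos hm]⟩

theorem LatePattern.toLate_toSkip (h : LatePattern i g κ s) (hg : StrictAnti g) :
    toLate i g (toSkip i g κ s) s = κ := by
  funext m
  have hle := h.le
  by_cases hm : s ≤ g m ∧ g m ≤ i
  · rw [h.apply_eq hg hm.1 hm.2, toLate]
    split_ifs <;> first | omega | rfl
  · rw [toLate, if_neg (by omega), if_neg (by omega), toSkip, if_neg (by omega),
      if_neg (by omega)]

theorem SkipPattern.toSkip_toLate (h : SkipPattern i g κ s) (hg : StrictAnti g) :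
    toSkip i g (toLate i g κ s) s = κ := by
  funext m
  have hle := h.le
  by_cases hm : s ≤ g m ∧ g m ≤ i
  · rw [h.apply_eq hg hm.1 hm.2, toSkip]
    split_ifs <;> first | omega | rfl
  · rw [toSkip, if_neg (by omega), if_neg (by omega), toLate, if_neg (by omega),
      if_neg (by omega)]

/-- All kinds involved raise the position by exactly one, so exchanging them keeps the end points.
-/
theorem LatePattern.isStep_toSkip (h : LatePattern i g κ s) (hg : StrictAnti g)
    (hstep : ∀ m, (κ m).IsStep n i (g m) (f m)) (m : Fin k) :
    (toSkip i g κ s m).IsStep n i (g m) (f m) := by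
  have hle := h.le
  by_cases hm : s ≤ g m ∧ g m ≤ i
  · have hs := hstep m
    rw [h.apply_eq hg hm.1 hm.2] at hs
    have hf : f m = g m + 1 := by
      split_ifs at hs <;> exact hs.2
    rw [toSkip]
    split_ifs with h1 h2
    · exact ⟨h1, hf⟩
    · exact ⟨hm.2, hf⟩
    · omega
  · rw [toSkip, if_neg (by omega), if_neg (by omega)]
    exact hstep m

theorem SkipPattern.isStep_toLate (h : SkipPattern i g κ s) (hg : StrictAnti g)
    (hstep : ∀ m, (κ m).IsStep n i (g m) (f m)) (m : Fin k) :
    (toLate i g κ s m).IsStep n i (g m) (f m) := by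
  have hle := h.le
  by_cases hm : s ≤ g m ∧ g m ≤ i
  · have hs := hstep m
    rw [h.apply_eq hg hm.1 hm.2] at hs
    have hf : f m = g m + 1 := by
      split_ifs at hs <;> exact hs.2
    rw [toLate]
    split_ifs with h1 h2
    · exact ⟨hm.2, hf⟩
    · exact ⟨hm.2, hf⟩
    · omega
  · rw [toLate, if_neg (by omega), if_neg (by omega)]
    exact hstep m

/-- The new heights are `2s + 2, …, 2i` and `2i + 1`; paths from below `s` stay at height at most
`2s`, those from above `i` at least `2i + 2`. -/
theorem LatePattern.mid_toSkip (h : LatePattern i g κ s) (hg : StrictAnti g)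
    (hmid : StrictAnti fun m => (κ m).mid (g m)) :
    StrictAnti fun m => (toSkip i g κ s m).mid (g m) := by
  intro a b hab
  have h0 := hg hab
  have h1 := hmid hab
  have hle := h.le
  have h2 := (κ a).le_mid (g a)
  have h3 := (κ b).mid_le (g b)
  simp only [toSkip] at h1 ⊢
  split_ifs <;> (try simp only [Kind.mid_early, Kind.mid_skip]) <;> omega

/-- The new heights are `2s` and `2s + 4, …, 2i + 2`. A collision could only occur with a path from
`i + 1` or from `s - 1`, and disjointness of the end points rules this out together with the
minimality of `s`. -/
theorem SkipPattern.mid_toLate (h : SkipPattern i g κ s) (hg : StrictAnti g) (hf : StrictAnti f)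
    (hstep : ∀ m, (κ m).IsStep n i (g m) (f m))
    (hmid : StrictAnti fun m => (κ m).mid (g m)) :
    StrictAnti fun m => (toLate i g κ s m).mid (g m) := by
  have hle := h.le
  -- From `i + 1` only `straight` is possible, and it ends where the negative arc ends.
  have above : ∀ m, g m ≠ i + 1 := by
    intro m hm
    obtain ⟨m', hm', hk'⟩ := h.skip
    have hs := hstep m
    have hs' := hstep m'
    have hne : f m ≠ f m' := fun e => by
      rw [hf.injective e] at hm
      omega
    rw [hk'] at hs'
    cases hk : κ m <;> simp only [hk, Kind.IsStep] at hs hs' <;> omega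
  -- Early is excluded by minimality, and a double rise would end at `s + 1` like the path from `s`.
  have below : ∀ m, g m + 1 = s → (κ m).mid (g m) = 2 * g m := by
    intro m hm
    obtain ⟨m', hm'⟩ := h.occupied le_rfl h.le
    have hs := hstep m
    have hs' := hstep m'
    have hne : f m ≠ f m' := fun e => by
      rw [hf.injective e] at hm
      omega
    rw [h.apply_eq hg hm'.ge (hm'.trans_le hle)] at hs'
    have hf' : f m' = s + 1 := by
      rw [← hm']
      split_ifs at hs' <;> exact hs'.2
    have := h.ne_early m hm
    cases hk : κ m <;> simp only [hk, Kind.IsStep, Kind.mid, ne_eq, not_true_eq_false] at hs this ⊢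
      <;> omega
  intro a b hab
  have h0 := hg hab
  have h1 := hmid hab
  have h2 := (κ a).le_mid (g a)
  have h3 := (κ b).mid_le (g b)
  have h4 := above a
  have h5 := below b
  simp only [toLate] at h1 ⊢
  split_ifs <;> (try simp only [Kind.mid_late, Kind.mid_early]) <;> omega

/-- Every position in `[s, i]` contributes `X` except `e`: late patterns have `e = s`, `c = 1`, skip
patterns `e = i`, `c = -1`. -/
theorem prod_weight_eq (hg : StrictAnti g) (hocc : ∀ x, s ≤ x → x ≤ i → ∃ m, g m = x) {e : ℕ}
    (he : s ≤ e ∧ e ≤ i) (c : ℝ[X])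
    (hκ : ∀ m, s ≤ g m → g m ≤ i → (κ m).weight = if g m = e then c else X) :
    ∏ m, (κ m).weight =
      c * X ^ (i - s) * ∏ m with ¬ (s ≤ g m ∧ g m ≤ i), (κ m).weight := by
  rw [← Finset.prod_filter_mul_prod_filter_not _ (fun m => s ≤ g m ∧ g m ≤ i)]
  congr 1
  have h1 : ∏ m with s ≤ g m ∧ g m ≤ i, (κ m).weight =
      ∏ x ∈ Finset.Icc s i, if x = e then c else X := by
    refine Finset.prod_nbij g (by simp) hg.injective.injOn ?_ ?_
    · intro x hx
      rw [Finset.coe_Icc, Set.mem_Icc] at hx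
      obtain ⟨m, rfl⟩ := hocc x hx.1 hx.2
      exact ⟨m, by simpa using hx, rfl⟩
    · intro m hm
      rw [Finset.mem_filter] at hm
      exact hκ m hm.2.1 hm.2.2
  have he' : e ∈ Finset.Icc s i := Finset.mem_Icc.2 he
  rw [h1, ← Finset.mul_prod_erase _ _ he', if_pos rfl,
    Finset.prod_congr rfl fun x hx => if_neg (Finset.ne_of_mem_erase hx), Finset.prod_const,
    Finset.card_erase_of_mem he', Nat.card_Icc]
  congr 2
  omega

theorem LatePattern.prod_weight_toSkip (h : LatePattern i g κ s) (hg : StrictAnti g) :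
    ∏ m, (toSkip i g κ s m).weight = -∏ m, (κ m).weight := by
  have hle := h.le
  rw [prod_weight_eq hg (fun _ => h.occupied) (e := i) ⟨h.le, le_rfl⟩ (-1),
    prod_weight_eq hg (fun _ => h.occupied) (e := s) ⟨le_rfl, h.le⟩ 1, ← neg_mul, ← neg_mul]
  · congr 1
    refine Finset.prod_congr rfl fun m hm => ?_
    rw [Finset.mem_filter] at hm
    rw [toSkip, if_neg (by omega), if_neg (by omega)]
  · intro m h1 h2
    rw [h.apply_eq hg h1 h2]
    split_ifs <;> rfl
  · intro m h1 h2
    rw [toSkip]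
    split_ifs <;> first | omega | rfl

/-- The families of paths through a layer that are not fixed by the involution. -/
def LayerFam.Bad (ℓ : LayerFam n i g f) : Prop :=
  (∃ s, LatePattern i g ℓ.kind s) ∨ ∃ s, SkipPattern i g ℓ.kind s

open Classical in
/-- The sign-reversing involution of the families of disjoint paths through a layer. -/
noncomputable def LayerFam.flip (hg : StrictAnti g) (hf : StrictAnti f) (ℓ : LayerFam n i g f) :
    LayerFam n i g f :=
  if h : ∃ s, LatePattern i g ℓ.kind s then
    ⟨toSkip i g ℓ.kind h.choose, h.choose_spec.isStep_toSkip hg ℓ.isStep,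
      h.choose_spec.mid_toSkip hg ℓ.mid⟩
  else if h : ∃ s, SkipPattern i g ℓ.kind s then
    ⟨toLate i g ℓ.kind h.choose, h.choose_spec.isStep_toLate hg ℓ.isStep,
      h.choose_spec.mid_toLate hg hf ℓ.isStep ℓ.mid⟩
  else ℓ

namespace LayerFam

variable (hg : StrictAnti g) (hf : StrictAnti f) {ℓ : LayerFam n i g f}

theorem flip_of_late (h : LatePattern i g ℓ.kind s) :
    (ℓ.flip hg hf).kind = toSkip i g ℓ.kind s := by
  have hex : ∃ s, LatePattern i g ℓ.kind s := ⟨s, h⟩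
  rw [flip, dif_pos hex, h.unique hex.choose_spec hg]

theorem flip_of_skip (h : SkipPattern i g ℓ.kind s) :
    (ℓ.flip hg hf).kind = toLate i g ℓ.kind s := by
  have hex : ∃ s, SkipPattern i g ℓ.kind s := ⟨s, h⟩
  rw [flip, dif_neg fun ⟨t, ht⟩ => h.not_latePattern hg ht, dif_pos hex,
    h.unique hex.choose_spec]

theorem flip_of_not_bad (h : ¬ ℓ.Bad) : ℓ.flip hg hf = ℓ := by
  rw [Bad, not_or] at h
  rw [flip, dif_neg h.1, dif_neg h.2]

theorem flip_flip (ℓ : LayerFam n i g f) : (ℓ.flip hg hf).flip hg hf = ℓ := by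
  by_cases h : ℓ.Bad
  · rcases h with ⟨s, h⟩ | ⟨s, h⟩
    · have h1 := flip_of_late hg hf h
      have h2 := h.skipPattern_toSkip ℓ.mid
      rw [← h1] at h2
      exact LayerFam.ext (by rw [flip_of_skip hg hf h2, h1, h.toLate_toSkip hg])
    · have h1 := flip_of_skip hg hf h
      have h2 := h.latePattern_toLate
      rw [← h1] at h2
      exact LayerFam.ext (by rw [flip_of_late hg hf h2, h1, h.toSkip_toLate hg])
  · rw [flip_of_not_bad hg hf h, flip_of_not_bad hg hf h]

theorem weight_flip (h : ℓ.Bad) : (ℓ.flip hg hf).weight = -ℓ.weight := by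
  rcases h with ⟨s, h⟩ | ⟨s, h⟩
  · rw [weight, flip_of_late hg hf h, h.prod_weight_toSkip hg]
    rfl
  · have h2 := h.latePattern_toLate.prod_weight_toSkip hg
    rw [h.toSkip_toLate hg] at h2
    rw [weight, weight, flip_of_skip hg hf h, h2, neg_neg]

theorem weight_ne_zero (ℓ : LayerFam n i g f) : ℓ.weight ≠ 0 := by
  refine Finset.prod_ne_zero_iff.2 fun m _ => ?_
  cases ℓ.kind m <;> simp [Kind.weight]

/-- A bad fixed point would have a weight equal to its negative, hence zero. -/
theorem flip_eq_iff : ℓ.flip hg hf = ℓ ↔ ¬ ℓ.Bad := by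
  refine ⟨fun h hb => ?_, flip_of_not_bad hg hf⟩
  have := weight_flip hg hf hb
  rw [h, self_eq_neg] at this
  exact weight_ne_zero ℓ this

theorem bad_of_skip {m : Fin k} (h : ℓ.kind m = .skip) : ℓ.Bad := by
  have hs := ℓ.isStep m
  rw [h] at hs
  exact Or.inr (exists_skipPattern ⟨m, hs.1, h⟩)

end LayerFam

end LayerInvolution

/-! ### Families of disjoint paths through several layers -/

theorem DecSeq.pos_strictAnti {n k : ℕ} (g : DecSeq k (Fin (n + 1))) : StrictAnti g.pos :=
  fun _ _ h => g.2 h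

theorem LayerFam.Bad.flip {n i k : ℕ} {g f : Fin k → ℕ} (hg : StrictAnti g) (hf : StrictAnti f)
    {ℓ : LayerFam n i g f} (h : ℓ.Bad) : (ℓ.flip hg hf).Bad := by
  by_contra hb
  have h1 := LayerFam.flip_of_not_bad hg hf hb
  rw [LayerFam.flip_flip] at h1
  exact (LayerFam.flip_eq_iff hg hf).1 h1.symm h

section NetFam

variable {n k : ℕ} {A A' : DecSeq k (Fin (n + 1))}

/-- The families of disjoint paths through the first layers of `D^{B_n}`, starting in the positions
`A`. The indices are the number of layers and the positions of the end points. -/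
inductive NetFam (A : DecSeq k (Fin (n + 1))) : ℕ → DecSeq k (Fin (n + 1)) → Type
  | nil : NetFam A 0 A
  | cons {i : ℕ} {g f : DecSeq k (Fin (n + 1))} (c : NetFam A i g)
      (ℓ : LayerFam n i g.pos f.pos) : NetFam A (i + 1) f

namespace NetFam

/-- A family of paths through `i + 1` layers consists of one through `i` layers and one through
the last layer. -/
def succEquiv (i : ℕ) (f : DecSeq k (Fin (n + 1))) :
    NetFam A (i + 1) f ≃ Σ g : DecSeq k (Fin (n + 1)), NetFam A i g × LayerFam n i g.pos f.pos where
  toFun := fun | cons c ℓ => ⟨_, c, ℓ⟩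
  invFun x := cons x.2.1 x.2.2
  left_inv := by rintro (_ | _); rfl
  right_inv _ := rfl

instance (i : ℕ) (f : DecSeq k (Fin (n + 1))) : Finite (NetFam A i f) := by
  induction i generalizing f with
  | zero =>
    have : Subsingleton (NetFam A 0 f) := ⟨by rintro ⟨⟩ ⟨⟩; rfl⟩
    infer_instance
  | succ i ih => exact Finite.of_equiv _ (succEquiv i f).symm

noncomputable instance (i : ℕ) (f : DecSeq k (Fin (n + 1))) : Fintype (NetFam A i f) :=
  Fintype.ofFinite _

/-- The weight of a family of paths through several layers. -/
noncomputable def weight : ∀ {i : ℕ} {f : DecSeq k (Fin (n + 1))}, NetFam A i f → ℝ[X]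
  | _, _, nil => 1
  | _, _, cons c ℓ => c.weight * ℓ.weight

/-- The path count for half of the network, one layer at a time; without layers both sides are
Kronecker deltas. -/
theorem sum_weight {i : ℕ} (hi : i ≤ n) (f : DecSeq k (Fin (n + 1))) :
    ∑ c : NetFam A i f, c.weight = ((networkMatrix n i).submatrix A.1 f.1).det := by
  induction i generalizing f with
  | zero =>
    have h1 : Noncrossing (1 : Matrix (Fin (n + 1)) (Fin (n + 1)) ℝ[X]) := by
      intro a a' b b' h h1 h2
      rw [Matrix.one_apply, ne_eq, ite_eq_right_iff, Classical.not_imp] at h1 h2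
      rw [← h1.1, ← h2.1]
      exact h.le
    rw [networkMatrix, h1.det_submatrix]
    by_cases h : A = f
    · subst h
      have : Unique (NetFam A 0 A) := ⟨⟨nil⟩, by rintro ⟨⟩; rfl⟩
      rw [Fintype.sum_unique]
      have hd : (default : NetFam A 0 A) = nil := Unique.eq_default _ |>.symm
      simp [hd, weight]
    · have : IsEmpty (NetFam A 0 f) := ⟨by rintro ⟨⟩; exact h rfl⟩
      rw [Fintype.sum_empty]
      obtain ⟨m, hm⟩ : ∃ m, A.1 m ≠ f.1 m := by
        by_contra! hh
        exact h (Subtype.ext (funext hh))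
      rw [Finset.prod_eq_zero (Finset.mem_univ m) (by rw [Matrix.one_apply, if_neg hm])]
  | succ i ih =>
    have h1 : (networkMatrix n (i + 1)).submatrix A.1 f.1 =
        ((networkMatrix n i).submatrix A.1 id * layerMatrix n i).submatrix id f.1 := rfl
    rw [h1, det_mul_layerMatrix (by omega), Fintype.sum_equiv (succEquiv i f) _
      (fun x => x.2.1.weight * x.2.2.weight) (by rintro (_ | _); rfl), Fintype.sum_sigma]
    refine Finset.sum_congr rfl fun g _ => ?_
    rw [Fintype.sum_prod_type]
    simp only
    rw [← Finset.sum_mul_sum, ih (by omega)]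
    rfl

/-- The families of paths that are not fixed by the involution. -/
def Bad : ∀ {i : ℕ} {f : DecSeq k (Fin (n + 1))}, NetFam A i f → Prop
  | _, _, nil => False
  | _, _, cons c ℓ => c.Bad ∨ ℓ.Bad

open Classical in
/-- The sign-reversing involution, which changes a family in the first possible layer. -/
noncomputable def flip : ∀ {i : ℕ} {f : DecSeq k (Fin (n + 1))}, NetFam A i f → NetFam A i f
  | _, _, nil => nil
  | _, _, cons (g := g) (f := f) c ℓ =>
    if c.Bad then cons c.flip ℓ else cons c (ℓ.flip g.pos_strictAnti f.pos_strictAnti)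

variable {i : ℕ} {f g : DecSeq k (Fin (n + 1))}

theorem flip_cons_of_bad {c : NetFam A i g} (h : c.Bad) (ℓ : LayerFam n i g.pos f.pos) :
    (cons c ℓ).flip = cons c.flip ℓ := by
  rw [flip, if_pos h]

theorem flip_cons_of_not_bad {c : NetFam A i g} (h : ¬ c.Bad) (ℓ : LayerFam n i g.pos f.pos) :
    (cons c ℓ).flip = cons c (ℓ.flip g.pos_strictAnti f.pos_strictAnti) := by
  rw [flip, if_neg h]

theorem flip_of_not_bad (c : NetFam A i f) (h : ¬ c.Bad) : c.flip = c := by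
  cases c with
  | nil => rfl
  | cons c ℓ =>
    rw [Bad, not_or] at h
    rw [flip_cons_of_not_bad h.1, LayerFam.flip_of_not_bad _ _ h.2]

theorem Bad.flip {c : NetFam A i f} (h : c.Bad) : c.flip.Bad := by
  induction c with
  | nil => exact h
  | cons c ℓ ih =>
    by_cases hc : c.Bad
    · rw [flip_cons_of_bad hc]
      exact Or.inl (ih hc)
    · rw [flip_cons_of_not_bad hc]
      exact Or.inr (LayerFam.Bad.flip _ _ (h.resolve_left hc))

/-- Flipping preserves badness, so the second application picks the same layer. -/
theorem flip_flip (c : NetFam A i f) : c.flip.flip = c := by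
  induction c with
  | nil => rfl
  | cons c ℓ ih =>
    by_cases hc : c.Bad
    · rw [flip_cons_of_bad hc, flip_cons_of_bad hc.flip, ih]
    · rw [flip_cons_of_not_bad hc, flip_cons_of_not_bad hc, LayerFam.flip_flip]

theorem weight_flip {c : NetFam A i f} (h : c.Bad) : c.flip.weight = -c.weight := by
  induction c with
  | nil => exact h.elim
  | cons c ℓ ih =>
    by_cases hc : c.Bad
    · rw [flip_cons_of_bad hc, weight, weight, ih hc, neg_mul]
    · rw [flip_cons_of_not_bad hc, weight, weight,
        LayerFam.weight_flip _ _ (h.resolve_left hc), mul_neg]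

theorem weight_ne_zero (c : NetFam A i f) : c.weight ≠ 0 := by
  induction c with
  | nil => exact one_ne_zero
  | cons c ℓ ih => exact mul_ne_zero ih ℓ.weight_ne_zero

end NetFam

/-- The families of disjoint paths through `D^{H_n}` from the positions `A` to the mirror images of
the positions `A'`. -/
abbrev FullFam (A A' : DecSeq k (Fin (n + 1))) : Type :=
  Σ f : DecSeq k (Fin (n + 1)), NetFam A n f × NetFam A' n f

namespace FullFam

/-- The weight of a family of paths through `D^{H_n}`. -/
noncomputable def weight (t : FullFam A A') : ℝ[X] :=
  t.2.1.weight * ((∏ m, tEntry (n - t.1.pos m)) * t.2.2.weight)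

/-- The families of paths that are not fixed by the involution. -/
def Bad (t : FullFam A A') : Prop := t.2.1.Bad ∨ t.2.2.Bad

open Classical in
/-- The sign-reversing involution. -/
noncomputable def flip (t : FullFam A A') : FullFam A A' :=
  if t.2.1.Bad then ⟨t.1, t.2.1.flip, t.2.2⟩ else ⟨t.1, t.2.1, t.2.2.flip⟩

theorem flip_of_bad {t : FullFam A A'} (h : t.2.1.Bad) : t.flip = ⟨t.1, t.2.1.flip, t.2.2⟩ :=
  if_pos h

theorem flip_of_not_bad_left {t : FullFam A A'} (h : ¬ t.2.1.Bad) :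
    t.flip = ⟨t.1, t.2.1, t.2.2.flip⟩ :=
  if_neg h

theorem flip_of_not_bad {t : FullFam A A'} (h : ¬ t.Bad) : t.flip = t := by
  rw [Bad, not_or] at h
  rw [flip_of_not_bad_left h.1, NetFam.flip_of_not_bad _ h.2]

theorem flip_flip (t : FullFam A A') : t.flip.flip = t := by
  by_cases h : t.2.1.Bad
  · rw [flip_of_bad h, flip_of_bad h.flip, NetFam.flip_flip]
  · rw [flip_of_not_bad_left h, flip_of_not_bad_left (t := ⟨t.1, t.2.1, t.2.2.flip⟩) h,
      NetFam.flip_flip]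

theorem weight_flip {t : FullFam A A'} (h : t.Bad) : t.flip.weight = -t.weight := by
  by_cases h1 : t.2.1.Bad
  · rw [flip_of_bad h1, weight, weight, NetFam.weight_flip h1, neg_mul]
  · rw [flip_of_not_bad_left h1, weight, weight, NetFam.weight_flip (h.resolve_left h1), mul_neg,
      mul_neg]

theorem weight_ne_zero (t : FullFam A A') : t.weight ≠ 0 := by
  refine mul_ne_zero (NetFam.weight_ne_zero _) (mul_ne_zero ?_ (NetFam.weight_ne_zero _))
  refine Finset.prod_ne_zero_iff.2 fun m _ => ?_
  rw [tEntry]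
  split_ifs <;> simp

theorem flip_eq_iff {t : FullFam A A'} : t.flip = t ↔ ¬ t.Bad := by
  refine ⟨fun h hb => ?_, flip_of_not_bad⟩
  have := weight_flip hb
  rw [h, self_eq_neg] at this
  exact weight_ne_zero t this

theorem Bad.flip {t : FullFam A A'} (h : t.Bad) : t.flip.Bad := by
  by_contra hb
  have h1 := flip_of_not_bad hb
  rw [flip_flip] at h1
  exact flip_eq_iff.1 h1.symm h

open Classical in
theorem sum_weight_not_bad :
    ∑ t : FullFam A A' with ¬ t.Bad, t.weight = ∑ t : FullFam A A', t.weight := by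
  rw [← Finset.sum_filter_not_add_sum_filter Finset.univ (Bad (A := A) (A' := A')), left_eq_add]
  refine Finset.sum_involution (fun t _ => t.flip) (fun t ht => ?_) (fun t ht _ => ?_)
    (fun t ht => ?_) (fun t _ => flip_flip t)
  · rw [weight_flip (Finset.mem_filter.1 ht).2, add_neg_cancel]
  · exact fun h => flip_eq_iff.1 h (Finset.mem_filter.1 ht).2
  · exact Finset.mem_filter.2 ⟨Finset.mem_univ _, (Finset.mem_filter.1 ht).2.flip⟩

theorem sum_weight {I J : Fin k → Fin (n + 1)} (hI : StrictMono I) (hJ : StrictMono J) :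
    ∑ t : FullFam (revSeq hI) (revSeq hJ), t.weight = ((hankelTrunc n).submatrix I J).det := by
  rw [det_hankelTrunc_submatrix hI hJ, Fintype.sum_sigma]
  refine Finset.sum_congr rfl fun f _ => ?_
  rw [← NetFam.sum_weight le_rfl, ← NetFam.sum_weight le_rfl, Finset.mul_sum, Finset.sum_mul_sum,
    Fintype.sum_prod_type]
  rfl

end FullFam

end NetFam

/-! ### Paths in `D^{B_n}` and `D^{H_n}` -/

instance (n : ℕ) : Quiver (BVertex n) where
  Hom := BArc n

section Paths

variable {n : ℕ}

/-- A path in `D^{B_n}` as a path in `D^{H_n}`. -/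
def leftPath {u : BVertex n} : ∀ {v : BVertex n}, Quiver.Path u v →
    Quiver.Path (Vertex.left u) (Vertex.left v)
  | _, .nil => .nil
  | _, .cons p a => .cons (leftPath p) (Arc.left a)

/-- The mirror image of a path in `D^{B_n}`. -/
def rightPath {u : BVertex n} : ∀ {v : BVertex n}, Quiver.Path u v →
    Quiver.Path (Vertex.right v) (Vertex.right u)
  | _, .nil => .nil
  | .(v), .cons (c := v) (b := w) p a =>
    .comp (Quiver.Hom.toPath (a := Vertex.right v) (b := Vertex.right w) (Arc.right a))
      (rightPath p)

/-- The arcs of a path in `D^{B_n}` that lie in the `i`-th layer. -/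
def layerArcs (i : ℕ) {u : BVertex n} : ∀ {v : BVertex n}, Quiver.Path u v → List (AnyArc n)
  | _, .nil => []
  | _, .cons p a => layerArcs i p ++ if BArc.layer a = i then [lArc a] else []

theorem layerArcs_cons (i : ℕ) {u v w : BVertex n} (p : Quiver.Path u v) (a : v ⟶ w) :
    layerArcs i (p.cons a) = layerArcs i p ++ if BArc.layer a = i then [lArc a] else [] := rfl

theorem layerArcs_comp (i : ℕ) {u v w : BVertex n} (p : Quiver.Path u v) (q : Quiver.Path v w) :
    layerArcs i (p.comp q) = layerArcs i p ++ layerArcs i q := by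
  induction q with
  | nil => simp [layerArcs]
  | cons q a ih => rw [Quiver.Path.comp_cons, layerArcs, layerArcs, ih, List.append_assoc]

theorem restrict_comp (s : Segment) {u v w : Vertex n} (p : Quiver.Path u v)
    (q : Quiver.Path v w) : restrict s (p.comp q) = restrict s p ++ restrict s q := by
  induction q with
  | nil => simp [restrict]
  | cons q a ih => rw [Quiver.Path.comp_cons, restrict, restrict, ih, List.append_assoc]

theorem restrict_toPath (s : Segment) {u v : Vertex n} (a : u ⟶ v) (h : Arc.segment a ≠ s) :
    restrict s a.toPath = [] := by
  rw [Quiver.Hom.toPath, restrict, restrict, if_neg h, List.append_nil]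

theorem reflect_append (l l' : List (AnyArc n)) : reflect (l ++ l') = reflect l' ++ reflect l := by
  simp [reflect]

theorem reflectArc_reflectArc (a : AnyArc n) : reflectArc (reflectArc a) = a := by
  obtain ⟨_, _, _ | _ | _⟩ := a <;> rfl

theorem reflect_reflect (l : List (AnyArc n)) : reflect (reflect l) = l := by
  simp only [reflect, List.map_reverse, List.reverse_reverse, List.map_map]
  conv_rhs => rw [← List.map_id l]
  exact List.map_congr_left fun a _ => reflectArc_reflectArc a

theorem restrict_leftPath (i : ℕ) {u v : BVertex n} (p : Quiver.Path u v) :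
    restrict (.left i) (leftPath p) = layerArcs i p := by
  induction p with
  | nil => rfl
  | cons p a ih =>
    rw [leftPath, restrict, layerArcs, ih, Arc.segment]
    simp only [Segment.left.injEq]
    rfl

theorem restrict_leftPath_eq_nil {s : Segment} (hs : ∀ i, s ≠ .left i) {u v : BVertex n}
    (p : Quiver.Path u v) : restrict s (leftPath p) = [] := by
  induction p with
  | nil => rfl
  | cons p a ih => rw [leftPath, restrict, ih, Arc.segment, if_neg (hs _).symm, List.append_nil]

theorem restrict_rightPath (i : ℕ) {u v : BVertex n} (p : Quiver.Path u v) :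
    restrict (.right i) (rightPath p) = reflect (layerArcs i p) := by
  induction p with
  | nil => rfl
  | cons p a ih =>
    rw [rightPath, restrict_comp, layerArcs, reflect_append, ih]
    congr 1
    rw [Quiver.Hom.toPath, restrict, restrict, List.nil_append, Arc.segment]
    simp only [Segment.right.injEq]
    split_ifs <;> rfl

theorem restrict_rightPath_eq_nil {s : Segment} (hs : ∀ i, s ≠ .right i) {u v : BVertex n}
    (p : Quiver.Path u v) : restrict s (rightPath p) = [] := by
  induction p with
  | nil => rfl
  | cons p a ih =>
    rw [rightPath, restrict_comp, ih, restrict_toPath _ _ (fun h => hs _ h.symm), List.append_nil]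

theorem mem_vertices_leftPath {u v : BVertex n} (p : Quiver.Path u v) (w : Vertex n) :
    w ∈ (leftPath p).vertices ↔ ∃ x ∈ p.vertices, w = .left x := by
  induction p with
  | nil => simp [leftPath]
  | cons p a ih =>
    rw [leftPath, Quiver.Path.mem_vertices_cons, ih]
    simp only [Quiver.Path.mem_vertices_cons, or_and_right, exists_or, exists_eq_left]

theorem mem_vertices_comp {V : Type*} [Quiver V] {a b c : V} (p : Quiver.Path a b)
    (q : Quiver.Path b c) (v : V) : v ∈ (p.comp q).vertices ↔ v ∈ p.vertices ∨ v ∈ q.vertices := by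
  induction q with
  | nil =>
    simp only [Quiver.Path.comp_nil, Quiver.Path.vertices_nil, List.mem_singleton]
    exact ⟨Or.inl, fun h => h.elim id fun h => h ▸ p.end_mem_vertices⟩
  | cons q a ih =>
    rw [Quiver.Path.comp_cons, Quiver.Path.mem_vertices_cons, Quiver.Path.mem_vertices_cons, ih,
      or_assoc]

theorem mem_vertices_rightPath {u v : BVertex n} (p : Quiver.Path u v) (w : Vertex n) :
    w ∈ (rightPath p).vertices ↔ ∃ x ∈ p.vertices, w = .right x := by
  induction p with
  | nil => simp [rightPath]
  | @cons b c p a ih =>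
    rw [rightPath, mem_vertices_comp, ih]
    simp only [Quiver.Path.mem_vertices_cons, or_and_right, exists_or, exists_eq_left,
      Quiver.Hom.toPath, Quiver.Path.vertices_nil, List.mem_singleton]
    constructor
    · rintro ((h | h) | h)
      · exact Or.inr h
      · exact Or.inl ⟨_, p.end_mem_vertices, h⟩
      · exact Or.inl h
    · rintro (h | h)
      · exact Or.inr h
      · exact Or.inl (Or.inl h)

/-- The weight of a path in `D^{B_n}`. -/
noncomputable def pathWeight {u v : BVertex n} (p : Quiver.Path u v) : ℝ[X] :=
  p.weight BArc.weight

theorem weight_leftPath {u v : BVertex n} (p : Quiver.Path u v) :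
    (leftPath p).weight Arc.weight = pathWeight p := by
  induction p with
  | nil => rw [pathWeight, Quiver.Path.weight_nil]; exact Quiver.Path.weight_nil _ _
  | cons p a ih =>
    rw [leftPath, Quiver.Path.weight_cons, ih, pathWeight, pathWeight, Quiver.Path.weight_cons]
    rfl

theorem weight_rightPath {u v : BVertex n} (p : Quiver.Path u v) :
    (rightPath p).weight Arc.weight = pathWeight p := by
  induction p with
  | nil => rw [pathWeight, Quiver.Path.weight_nil]; exact Quiver.Path.weight_nil _ _
  | cons p a ih =>
    rw [rightPath, Quiver.Path.weight_comp, ih, pathWeight, pathWeight, Quiver.Path.weight_cons,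
      mul_comm]
    congr 1
    rw [Quiver.Hom.toPath, Quiver.Path.weight_cons, Quiver.Path.weight_nil, one_mul]
    rfl

/-- The path in `D^{H_n}` that consists of a path in `D^{B_n}` and the mirror image of another one
with the same end point. -/
def joinPath {u v : BVertex n} {y : ℕ} {hy : y ≤ n} (p : Quiver.Path u (.P n y le_rfl hy))
    (q : Quiver.Path v (.P n y le_rfl hy)) : Quiver.Path (Vertex.left u) (Vertex.right v) :=
  ((leftPath p).cons (Arc.middle y hy)).comp (rightPath q)

/-- No arc leads from the mirrored half back to the left half. -/
theorem exists_eq_leftPath {u v : BVertex n} (q : Quiver.Path (Vertex.left u) (Vertex.left v)) :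
    ∃ p : Quiver.Path u v, q = leftPath p := by
  -- Induction on the length, since the end point `Vertex.left v` is not a free index of the path.
  obtain ⟨N, hN⟩ : ∃ N, q.length = N := ⟨_, rfl⟩
  induction N generalizing v with
  | zero =>
    cases q with
    | nil => exact ⟨.nil, rfl⟩
    | cons q a => cases hN
  | succ N ih =>
    cases q with
    | nil => cases hN
    | cons q a =>
      change Arc n _ _ at a
      cases a with
      | left a =>
        obtain ⟨p, rfl⟩ := ih q (Nat.succ_injective hN)
        exact ⟨p.cons a, rfl⟩

theorem rightPath_comp {u v w : BVertex n} (p : Quiver.Path u v) (q : Quiver.Path v w) :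
    rightPath (p.comp q) = (rightPath q).comp (rightPath p) := by
  induction q with
  | nil => simp [rightPath]
  | cons q a ih => rw [Quiver.Path.comp_cons, rightPath, rightPath, ih, Quiver.Path.comp_assoc]

theorem exists_eq_joinPath {u v : BVertex n} (q : Quiver.Path (Vertex.left u) (Vertex.right v)) :
    ∃ (y : ℕ) (hy : y ≤ n) (p₁ : Quiver.Path u (.P n y le_rfl hy))
      (p₂ : Quiver.Path v (.P n y le_rfl hy)), q = joinPath p₁ p₂ := by
  obtain ⟨N, hN⟩ : ∃ N, q.length = N := ⟨_, rfl⟩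
  induction N generalizing v with
  | zero =>
    cases q with
    | cons q a => cases hN
  | succ N ih =>
    cases q with
    | cons q a =>
      change Arc n _ _ at a
      cases a with
      | middle j hj =>
        obtain ⟨p, rfl⟩ := exists_eq_leftPath q
        exact ⟨j, hj, p, .nil, rfl⟩
      | @right v w a =>
        obtain ⟨y, hy, p₁, p₂, rfl⟩ := ih q (Nat.succ_injective hN)
        refine ⟨y, hy, p₁, (Quiver.Hom.toPath (a := v) (b := w) a).comp p₂, ?_⟩
        rw [joinPath, joinPath, rightPath_comp, ← Quiver.Path.comp_assoc]
        rfl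

theorem restrict_left_joinPath (i : ℕ) {u v : BVertex n} {y : ℕ} {hy : y ≤ n}
    (p : Quiver.Path u (.P n y le_rfl hy)) (q : Quiver.Path v (.P n y le_rfl hy)) :
    restrict (.left i) (joinPath p q) = layerArcs i p := by
  rw [joinPath, restrict_comp, restrict, restrict_leftPath, restrict_rightPath_eq_nil (by simp),
    if_neg (by simp [Arc.segment]), List.append_nil, List.append_nil]

theorem restrict_right_joinPath (i : ℕ) {u v : BVertex n} {y : ℕ} {hy : y ≤ n}
    (p : Quiver.Path u (.P n y le_rfl hy)) (q : Quiver.Path v (.P n y le_rfl hy)) :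
    restrict (.right i) (joinPath p q) = reflect (layerArcs i q) := by
  rw [joinPath, restrict_comp, restrict, restrict_leftPath_eq_nil (by simp), restrict_rightPath,
    if_neg (by simp [Arc.segment]), List.append_nil, List.nil_append]

theorem restrict_middle_joinPath {u v : BVertex n} {y : ℕ} {hy : y ≤ n}
    (p : Quiver.Path u (.P n y le_rfl hy)) (q : Quiver.Path v (.P n y le_rfl hy)) :
    restrict .middle (joinPath p q) = [⟨_, _, Arc.middle y hy⟩] := by
  rw [joinPath, restrict_comp, restrict, restrict_leftPath_eq_nil (by simp),
    restrict_rightPath_eq_nil (by simp), if_pos (by simp [Arc.segment]), List.append_nil,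
    List.nil_append]

theorem weight_joinPath {u v : BVertex n} {y : ℕ} {hy : y ≤ n}
    (p : Quiver.Path u (.P n y le_rfl hy)) (q : Quiver.Path v (.P n y le_rfl hy)) :
    (joinPath p q).weight Arc.weight = pathWeight p * (tEntry (n - y) * pathWeight q) := by
  rw [joinPath, Quiver.Path.weight_comp, Quiver.Path.weight_cons, weight_leftPath,
    weight_rightPath, mul_assoc]
  rfl

theorem mem_vertices_joinPath {u v : BVertex n} {y : ℕ} {hy : y ≤ n}
    (p : Quiver.Path u (.P n y le_rfl hy)) (q : Quiver.Path v (.P n y le_rfl hy))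
    (w : Vertex n) : w ∈ (joinPath p q).vertices ↔
      (∃ x ∈ p.vertices, w = .left x) ∨ ∃ x ∈ q.vertices, w = .right x := by
  rw [joinPath, mem_vertices_comp, Quiver.Path.mem_vertices_cons, mem_vertices_leftPath,
    mem_vertices_rightPath]
  constructor
  · rintro ((h | h) | h)
    · exact Or.inl h
    · exact Or.inr ⟨_, q.end_mem_vertices, h⟩
    · exact Or.inr h
  · rintro (h | h)
    · exact Or.inl (Or.inl h)
    · exact Or.inr h

end Paths

/-! ### Paths through a single layer -/

section Steps

variable {n i x y : ℕ}

/-- The path `P^{(i)}_{i-1} ⟶ Q^{(i)}_i ⟶ P^{(i+1)}_{i+1}` with the left one of the parallel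
arcs. -/
def doubleLeftPath (hi : i < n) (h : x + 1 = i) : Quiver.Path
    (BVertex.P i x hi.le (by omega)) (BVertex.P (i + 1) (x + 2) hi (by omega)) := by
  subst h
  exact .cons (.cons .nil (BArc.pqUp (x + 1) x hi (by omega))) (BArc.qpLeft (x + 1) hi)

/-- The path `P^{(i)}_{i-1} ⟶ Q^{(i)}_i ⟶ P^{(i+1)}_{i+1}` with the right one of the parallel
arcs. -/
def doubleRightPath (hi : i < n) (h : x + 1 = i) : Quiver.Path
    (BVertex.P i x hi.le (by omega)) (BVertex.P (i + 1) (x + 2) hi (by omega)) := by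
  subst h
  exact .cons (.cons .nil (BArc.pqUp (x + 1) x hi (by omega))) (BArc.qpRight (x + 1) hi)

/-- The path of a given kind through a layer. -/
def stepPath (hi : i < n) (hx : x ≤ n) (hy : y ≤ n) : ∀ κ : Kind, κ.IsStep n i x y →
    Quiver.Path (BVertex.P i x hi.le hx) (BVertex.P (i + 1) y hi hy)
  | .horiz, h => by
    obtain rfl : y = x := h.2.2
    exact .cons .nil (BArc.horiz i y hi h.1 hx)
  | .straight, h => by
    obtain rfl : y = x := h.2
    exact .cons (.cons .nil (BArc.pq i y hi h.1)) (BArc.qp i y hi h.1)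
  | .late, h => by
    obtain rfl : y = x + 1 := h.2
    exact if hlt : x < i then
        .cons (.cons .nil (BArc.pq i x hi (by omega))) (BArc.qpUp i x hi hlt)
      else by
        obtain rfl : x = i := le_antisymm h.1 (not_lt.1 hlt)
        exact .cons (.cons .nil (BArc.pq x x hi (by omega))) (BArc.qpLeft x hi)
  | .right, h => by
    obtain rfl : x = i := h.1
    obtain rfl : y = x + 1 := h.2
    exact .cons (.cons .nil (BArc.pq x x hi (by omega))) (BArc.qpRight x hi)
  | .early, h => by
    obtain rfl : y = x + 1 := h.2
    exact .cons (.cons .nil (BArc.pqUp i x hi h.1)) (BArc.qp i (x + 1) hi (by have := h.1; omega))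
  | .double, h => by
    obtain rfl : y = x + 2 := h.2
    exact if hlt : x + 1 < i then
        .cons (.cons .nil (BArc.pqUp i x hi (by omega))) (BArc.qpUp i (x + 1) hi hlt)
      else doubleLeftPath hi (le_antisymm h.1 (not_lt.1 hlt))
  | .doubleRight, h => by
    obtain rfl : y = x + 2 := h.2
    exact doubleRightPath hi h.1
  | .skip, h => by
    obtain rfl : x = i := h.1
    obtain rfl : y = x + 1 := h.2
    exact .cons .nil (BArc.skip x hi)

theorem stepPath_late_of_lt (hi : i < n) (hx : x ≤ n) (hy : x + 1 ≤ n)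
    (h : Kind.late.IsStep n i x (x + 1)) (hlt : x < i) : stepPath hi hx hy .late h =
      .cons (.cons .nil (BArc.pq i x hi (by omega))) (BArc.qpUp i x hi hlt) :=
  dif_pos hlt

theorem stepPath_late_self (hx : x < n) (hx' : x ≤ n) (hy : x + 1 ≤ n)
    (h : Kind.late.IsStep n x x (x + 1)) : stepPath hx hx' hy .late h =
      .cons (.cons .nil (BArc.pq x x hx (by omega))) (BArc.qpLeft x hx) :=
  dif_neg (lt_irrefl x)

theorem stepPath_double_of_lt (hi : i < n) (hx : x ≤ n) (hy : x + 2 ≤ n)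
    (h : Kind.double.IsStep n i x (x + 2)) (hlt : x + 1 < i) : stepPath hi hx hy .double h =
      .cons (.cons .nil (BArc.pqUp i x hi (by omega))) (BArc.qpUp i (x + 1) hi hlt) :=
  dif_pos hlt

theorem stepPath_double_self (hi : x + 1 < n) (hx : x ≤ n) (hy : x + 2 ≤ n)
    (h : Kind.double.IsStep n (x + 1) x (x + 2)) : stepPath hi hx hy .double h =
      .cons (.cons .nil (BArc.pqUp (x + 1) x hi (by omega))) (BArc.qpLeft (x + 1) hi) :=
  dif_neg (lt_irrefl (x + 1))

/-- A case distinction for paths through a layer. -/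
theorem stepPath_cases (hi : i < n)
    {motive : ∀ (x y : ℕ) (hx : x ≤ n) (hy : y ≤ n), Kind →
      Quiver.Path (BVertex.P i x hi.le hx) (BVertex.P (i + 1) y hi hy) → Prop}
    (horiz : ∀ x (h : i + 2 ≤ x) (hx : x ≤ n),
      motive x x hx hx .horiz (.cons .nil (BArc.horiz i x hi h hx)))
    (straight : ∀ x (h : x ≤ i + 1), motive x x (by omega) (by omega) .straight
      (.cons (.cons .nil (BArc.pq i x hi h)) (BArc.qp i x hi h)))
    (late : ∀ x (h : x < i), motive x (x + 1) (by omega) (by omega) .late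
      (.cons (.cons .nil (BArc.pq i x hi (by omega))) (BArc.qpUp i x hi h)))
    (left : motive i (i + 1) (by omega) (by omega) .late
      (.cons (.cons .nil (BArc.pq i i hi (by omega))) (BArc.qpLeft i hi)))
    (right : motive i (i + 1) (by omega) (by omega) .right
      (.cons (.cons .nil (BArc.pq i i hi (by omega))) (BArc.qpRight i hi)))
    (early : ∀ x (h : x ≤ i), motive x (x + 1) (by omega) (by omega) .early
      (.cons (.cons .nil (BArc.pqUp i x hi h)) (BArc.qp i (x + 1) hi (by omega))))
    (double : ∀ x (h : x + 1 < i), motive x (x + 2) (by omega) (by omega) .double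
      (.cons (.cons .nil (BArc.pqUp i x hi (by omega))) (BArc.qpUp i (x + 1) hi h)))
    (doubleLeft : ∀ x (h : x + 1 = i), motive x (x + 2) (by omega) (by omega) .double
      (doubleLeftPath hi h))
    (doubleRight : ∀ x (h : x + 1 = i), motive x (x + 2) (by omega) (by omega) .doubleRight
      (doubleRightPath hi h))
    (skip : motive i (i + 1) (by omega) (by omega) .skip (.cons .nil (BArc.skip i hi)))
    (hx : x ≤ n) (hy : y ≤ n) (κ : Kind) (h : κ.IsStep n i x y) :
    motive x y hx hy κ (stepPath hi hx hy κ h) := by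
  cases κ with
  | horiz =>
    obtain ⟨h1, h2, rfl⟩ := h
    exact horiz _ h1 h2
  | straight =>
    obtain ⟨h1, rfl⟩ := h
    exact straight _ h1
  | late =>
    obtain ⟨h1, rfl⟩ := h
    rcases h1.lt_or_eq with h2 | rfl
    · exact (congrArg (motive _ _ hx hy _) (stepPath_late_of_lt hi hx hy _ h2)).mpr (late _ h2)
    · exact (congrArg (motive _ _ hx hy _) (stepPath_late_self hi hx hy _)).mpr left
  | right =>
    obtain ⟨rfl, rfl⟩ := h
    exact right
  | early =>
    obtain ⟨h1, rfl⟩ := h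
    exact early _ h1
  | double =>
    obtain ⟨h1, rfl⟩ := h
    rcases h1.lt_or_eq with h2 | rfl
    · exact (congrArg (motive _ _ hx hy _) (stepPath_double_of_lt hi hx hy _ h2)).mpr
        (double _ h2)
    · exact (congrArg (motive _ _ hx hy _) (stepPath_double_self hi hx hy _)).mpr
        (doubleLeft _ rfl)
  | doubleRight =>
    obtain ⟨rfl, rfl⟩ := h
    exact doubleRight _ rfl
  | skip =>
    obtain ⟨rfl, rfl⟩ := h
    exact skip

/-! ### Recovering kinds, weights and vertices from arcs -/

/-- A code for the arcs of `D^{B_n}`. -/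
def BArc.tag : ∀ {u v : BVertex n}, BArc n u v → ℕ × ℕ
  | _, _, horiz _ j .. => (0, j)
  | _, _, pq _ j .. => (1, j)
  | _, _, pqUp _ j .. => (2, j)
  | _, _, qp _ j .. => (3, j)
  | _, _, qpUp _ j .. => (4, j)
  | _, _, skip i .. => (5, i)
  | _, _, qpLeft i .. => (6, i)
  | _, _, qpRight i .. => (7, i)

/-- A code for the arcs of `D^{H_n}`. -/
def arcTag : AnyArc n → ℕ × ℕ
  | ⟨_, _, .left a⟩ => a.tag
  | ⟨_, _, .middle j _⟩ => (8, j)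
  | ⟨_, _, .right a⟩ => a.tag

/-- The kind and the starting position of a path through a layer in terms of the codes of its
arcs. -/
def decodeTags : List (ℕ × ℕ) → Kind × ℕ
  | [(0, x)] => (.horiz, x)
  | [(1, x), (3, _)] => (.straight, x)
  | [(1, x), (4, _)] => (.late, x)
  | [(1, x), (6, _)] => (.late, x)
  | [(1, x), (7, _)] => (.right, x)
  | [(2, x), (3, _)] => (.early, x)
  | [(2, x), (4, _)] => (.double, x)
  | [(2, x), (6, _)] => (.double, x)
  | [(2, x), (7, _)] => (.doubleRight, x)
  | [(5, x)] => (.skip, x)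
  -- An arbitrary value: the arcs of a path through a layer never produce such a list.
  | _ => (.horiz, 0)

/-- The kind and the starting position of a path through a layer in terms of its arcs. -/
def decodeArcs (l : List (AnyArc n)) : Kind × ℕ := decodeTags (l.map arcTag)

theorem layerArcs_one (i : ℕ) {u v : BVertex n} (a : u ⟶ v) (h : BArc.layer a = i) :
    layerArcs i (Quiver.Path.nil.cons a) = [lArc a] := by
  rw [layerArcs_cons, if_pos h]
  rfl

theorem layerArcs_two (i : ℕ) {u v w : BVertex n} (a : u ⟶ v) (b : v ⟶ w)
    (ha : BArc.layer a = i) (hb : BArc.layer b = i) :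
    layerArcs i ((Quiver.Path.nil.cons a).cons b) = [lArc a, lArc b] := by
  rw [layerArcs_cons, layerArcs_one i a ha, if_pos hb]
  rfl

theorem decodeArcs_one (i : ℕ) {u v : BVertex n} (a : u ⟶ v) (h : BArc.layer a = i)
    {r : Kind × ℕ} (hr : decodeTags [BArc.tag a] = r) :
    decodeArcs (layerArcs i (Quiver.Path.nil.cons a)) = r := by
  rw [layerArcs_one i a h]
  exact hr

theorem decodeArcs_two (i : ℕ) {u v w : BVertex n} (a : u ⟶ v) (b : v ⟶ w)
    (ha : BArc.layer a = i) (hb : BArc.layer b = i) {r : Kind × ℕ}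
    (hr : decodeTags [BArc.tag a, BArc.tag b] = r) :
    decodeArcs (layerArcs i ((Quiver.Path.nil.cons a).cons b)) = r := by
  rw [layerArcs_two i a b ha hb]
  exact hr

theorem decodeArcs_stepPath (hi : i < n) (hx : x ≤ n) (hy : y ≤ n) (κ : Kind)
    (h : κ.IsStep n i x y) : decodeArcs (layerArcs i (stepPath hi hx hy κ h)) = (κ, x) := by
  refine stepPath_cases hi
    (motive := fun x _ _ _ κ p => decodeArcs (layerArcs i p) = (κ, x))
    ?_ ?_ ?_ ?_ ?_ ?_ ?_ ?_ ?_ ?_ hx hy κ h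
  · intro x _ _; exact decodeArcs_one _ _ (by rfl) (by rfl)
  · intro x _; exact decodeArcs_two _ _ _ (by rfl) (by rfl) (by rfl)
  · intro x _; exact decodeArcs_two _ _ _ (by rfl) (by rfl) (by rfl)
  · exact decodeArcs_two _ _ _ (by rfl) (by rfl) (by rfl)
  · exact decodeArcs_two _ _ _ (by rfl) (by rfl) (by rfl)
  · intro x _; exact decodeArcs_two _ _ _ (by rfl) (by rfl) (by rfl)
  · intro x _; exact decodeArcs_two _ _ _ (by rfl) (by rfl) (by rfl)
  · rintro x rfl; exact decodeArcs_two _ _ _ (by rfl) (by rfl) (by rfl)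
  · rintro x rfl; exact decodeArcs_two _ _ _ (by rfl) (by rfl) (by rfl)
  · exact decodeArcs_one _ _ (by rfl) (by rfl)

theorem pathWeight_one {u v : BVertex n} (a : u ⟶ v) :
    pathWeight (Quiver.Path.nil.cons a) = BArc.weight a := by
  rw [pathWeight, Quiver.Path.weight_cons, Quiver.Path.weight_nil, one_mul]

theorem pathWeight_two {u v w : BVertex n} (a : u ⟶ v) (b : v ⟶ w) :
    pathWeight ((Quiver.Path.nil.cons a).cons b) = BArc.weight a * BArc.weight b := by
  rw [pathWeight, Quiver.Path.weight_cons, ← pathWeight, pathWeight_one]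

theorem pathWeight_stepPath (hi : i < n) (hx : x ≤ n) (hy : y ≤ n) (κ : Kind)
    (h : κ.IsStep n i x y) : pathWeight (stepPath hi hx hy κ h) = κ.weight := by
  refine stepPath_cases hi (motive := fun _ _ _ _ κ p => pathWeight p = κ.weight)
    ?_ ?_ ?_ ?_ ?_ ?_ ?_ ?_ ?_ ?_ hx hy κ h
  · intro x _ _; exact pathWeight_one _
  · intro x _; exact (pathWeight_two _ _).trans (one_mul 1)
  · intro x _; exact (pathWeight_two _ _).trans (one_mul 1)
  · exact (pathWeight_two _ _).trans (one_mul 1)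
  · exact (pathWeight_two _ _).trans (one_mul 1)
  · intro x _; exact (pathWeight_two _ _).trans (mul_one X)
  · intro x _; exact (pathWeight_two _ _).trans (mul_one X)
  · rintro x rfl; exact (pathWeight_two _ _).trans (mul_one X)
  · rintro x rfl; exact (pathWeight_two _ _).trans (mul_one X)
  · exact pathWeight_one _

theorem mem_vertices_one {u v : BVertex n} (a : u ⟶ v) (w : BVertex n) :
    w ∈ (Quiver.Path.nil.cons a).vertices ↔ w = u ∨ w = v := by
  rw [Quiver.Path.mem_vertices_cons, Quiver.Path.vertices_nil, List.mem_singleton]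

theorem mem_vertices_two {u v₁ v₂ : BVertex n} (a : u ⟶ v₁) (b : v₁ ⟶ v₂) (w : BVertex n) :
    w ∈ ((Quiver.Path.nil.cons a).cons b).vertices ↔ w = u ∨ w = v₂ ∨ w = v₁ := by
  rw [Quiver.Path.mem_vertices_cons, mem_vertices_one, or_assoc, or_comm (a := w = v₁)]

theorem exists_eq_Q_iff (hi : i < n) {κ : Kind} {c : ℕ} (hc : c ≤ i + 1) (h : κ ≠ .horiz)
    (hm : κ.mid x = 2 * c) (v : BVertex n) : v = .Q i c hi hc ↔
      ∃ j hj, v = .Q i j hi hj ∧ κ ≠ .horiz ∧ κ.mid x = 2 * j := by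
  refine ⟨fun hv => ⟨c, hc, hv, h, hm⟩, ?_⟩
  rintro ⟨j, hj, rfl, -, h2⟩
  obtain rfl : j = c := by omega
  rfl

theorem mem_vertices_stepPath (hi : i < n) (hx : x ≤ n) (hy : y ≤ n) (κ : Kind)
    (h : κ.IsStep n i x y) (v : BVertex n) : v ∈ (stepPath hi hx hy κ h).vertices ↔
      v = .P i x hi.le hx ∨ v = .P (i + 1) y hi hy ∨
        ∃ j hj, v = .Q i j hi hj ∧ κ ≠ .horiz ∧ κ.mid x = 2 * j := by
  refine stepPath_cases hi (motive := fun x y hx hy κ p => v ∈ p.vertices ↔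
      v = .P i x hi.le hx ∨ v = .P (i + 1) y hi hy ∨
        ∃ j hj, v = .Q i j hi hj ∧ κ ≠ .horiz ∧ κ.mid x = 2 * j)
    ?_ ?_ ?_ ?_ ?_ ?_ ?_ ?_ ?_ ?_ hx hy κ h
  · intro x _ _
    rw [mem_vertices_one]
    simp
  · intro x hx
    rw [mem_vertices_two, ← exists_eq_Q_iff hi hx (by simp) rfl]
  · intro x hx
    rw [mem_vertices_two, ← exists_eq_Q_iff hi (show x ≤ i + 1 by omega) (by simp) rfl]
  · rw [mem_vertices_two, ← exists_eq_Q_iff hi (show i ≤ i + 1 by omega) (by simp) rfl]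
  · rw [mem_vertices_two, ← exists_eq_Q_iff hi (show i ≤ i + 1 by omega) (by simp) rfl]
  · intro x hx
    rw [mem_vertices_two, ← exists_eq_Q_iff hi (show x + 1 ≤ i + 1 by omega) (by simp) rfl]
  · intro x hx
    rw [mem_vertices_two, ← exists_eq_Q_iff hi (show x + 1 ≤ i + 1 by omega) (by simp) rfl]
  · rintro x rfl
    rw [← exists_eq_Q_iff hi (show x + 1 ≤ x + 1 + 1 by omega) (by simp) rfl]
    exact mem_vertices_two _ _ _
  · rintro x rfl
    rw [← exists_eq_Q_iff hi (show x + 1 ≤ x + 1 + 1 by omega) (by simp) rfl]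
    exact mem_vertices_two _ _ _
  · rw [mem_vertices_one]
    -- The odd height of the negative arc belongs to no vertex `Q`.
    have : ∀ j, Kind.skip.mid i ≠ 2 * j := fun j hj => by
      rw [Kind.mid_skip] at hj
      omega
    simp [this]

/-! ### Separating the layers by rank -/

/-- The height of a vertex in `D^{B_n}`. -/
def BVertex.rank : BVertex n → ℕ
  | P i .. => 2 * i
  | Q i .. => 2 * i + 1

theorem BArc.rank_lt {u v : BVertex n} (a : BArc n u v) : u.rank < v.rank := by
  cases a <;> simp only [BVertex.rank] <;> omega

theorem BArc.layer_lt {u v : BVertex n} (a : BArc n u v) : 2 * a.layer < v.rank := by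
  cases a <;> simp only [BVertex.rank, BArc.layer] <;> omega

theorem rank_le_of_mem_vertices {u v w : BVertex n} (p : Quiver.Path u v) (h : w ∈ p.vertices) :
    w.rank ≤ v.rank := by
  induction p with
  | nil =>
    rw [Quiver.Path.vertices_nil, List.mem_singleton] at h
    rw [h]
  | cons p a ih =>
    rw [Quiver.Path.mem_vertices_cons] at h
    rcases h with h | rfl
    · exact (ih h).trans (BArc.rank_lt a).le
    · exact le_rfl

theorem layerArcs_eq_nil_of_rank_le {u v : BVertex n} (p : Quiver.Path u v) {j : ℕ}
    (h : v.rank ≤ 2 * j) : layerArcs j p = [] := by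
  induction p with
  | nil => rfl
  | cons p a ih =>
    have h1 := BArc.rank_lt a
    have h2 := BArc.layer_lt a
    rw [layerArcs_cons, ih (by omega), if_neg (by omega), List.append_nil]

theorem layerArcs_stepPath_of_ne (hi : i < n) (hx : x ≤ n) (hy : y ≤ n) (κ : Kind)
    (h : κ.IsStep n i x y) {j : ℕ} (hj : i ≠ j) : layerArcs j (stepPath hi hx hy κ h) = [] := by
  have h1 : ∀ {u v : BVertex n} (a : u ⟶ v), BArc.layer a = i →
      layerArcs j (Quiver.Path.nil.cons a) = [] := fun a ha => by
    rw [layerArcs_cons, if_neg (ha.trans_ne hj)]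
    rfl
  have h2 : ∀ {u v w : BVertex n} (a : u ⟶ v) (b : v ⟶ w), BArc.layer a = i → BArc.layer b = i →
      layerArcs j ((Quiver.Path.nil.cons a).cons b) = [] := fun a b ha hb => by
    rw [layerArcs_cons, h1 a ha, if_neg (hb.trans_ne hj)]
    rfl
  refine stepPath_cases hi (motive := fun _ _ _ _ _ p => layerArcs j p = [])
    ?_ ?_ ?_ ?_ ?_ ?_ ?_ ?_ ?_ ?_ hx hy κ h
  · intro x _ _; exact h1 _ rfl
  · intro x _; exact h2 _ _ rfl rfl
  · intro x _; exact h2 _ _ rfl rfl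
  · exact h2 _ _ rfl rfl
  · exact h2 _ _ rfl rfl
  · intro x _; exact h2 _ _ rfl rfl
  · intro x _; exact h2 _ _ rfl rfl
  · rintro x rfl; exact h2 _ _ rfl rfl
  · rintro x rfl; exact h2 _ _ rfl rfl
  · exact h1 _ rfl

/-- The last arc either starts at a `P^{(i)}` already or starts at a `Q^{(i)}`, whose only incoming
arcs come from vertices `P^{(i)}`; the cases are the kinds. -/
theorem exists_eq_comp_stepPath {a : ℕ} {ha : a ≤ n} {hi : i + 1 ≤ n} {hy : y ≤ n}
    (p : Quiver.Path (BVertex.P 0 a (Nat.zero_le n) ha) (BVertex.P (i + 1) y hi hy)) :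
    ∃ (x : ℕ) (hx : x ≤ n) (κ : Kind) (h : κ.IsStep n i x y)
      (p' : Quiver.Path (BVertex.P 0 a (Nat.zero_le n) ha) (BVertex.P i x (Nat.le_of_lt hi) hx)),
      p = p'.comp (stepPath hi hx hy κ h) := by
  cases p with
  | cons p e =>
    change BArc n _ _ at e
    cases e with
    | horiz _ _ _ hij _ => exact ⟨y, hy, .horiz, ⟨hij, hy, rfl⟩, p, rfl⟩
    | skip => exact ⟨i, by omega, .skip, ⟨rfl, rfl⟩, p, rfl⟩
    | qp _ _ _ hj =>
      cases p with
      | cons p e =>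
        change BArc n _ _ at e
        cases e with
        | pq => exact ⟨y, hy, .straight, ⟨hj, rfl⟩, p, rfl⟩
        | pqUp _ j _ hj => exact ⟨j, by omega, .early, ⟨by assumption, rfl⟩, p, rfl⟩
    | qpUp _ j _ hj =>
      cases p with
      | cons p e =>
        change BArc n _ _ at e
        cases e with
        | pq =>
          refine ⟨j, by omega, .late, ⟨hj.le, rfl⟩, p, ?_⟩
          exact (congrArg p.comp (stepPath_late_of_lt hi (by omega) hy _ hj)).symm
        | pqUp _ j =>
          refine ⟨j, by omega, .double, ⟨hj.le, rfl⟩, p, ?_⟩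
          exact (congrArg p.comp (stepPath_double_of_lt hi (by omega) hy _ hj)).symm
    | qpLeft =>
      cases p with
      | cons p e =>
        change BArc n _ _ at e
        cases e with
        | pq =>
          refine ⟨i, by omega, .late, ⟨le_rfl, rfl⟩, p, ?_⟩
          exact (congrArg p.comp (stepPath_late_self hi (by omega) hy _)).symm
        | pqUp _ j =>
          refine ⟨j, by omega, .double, ⟨le_rfl, rfl⟩, p, ?_⟩
          exact (congrArg p.comp (stepPath_double_self hi (by omega) hy _)).symm
    | qpRight =>
      cases p with
      | cons p e =>
        change BArc n _ _ at e
        cases e with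
        | pq => exact ⟨i, by omega, .right, ⟨rfl, rfl⟩, p, rfl⟩
        | pqUp _ j => exact ⟨j, by omega, .doubleRight, ⟨rfl, rfl⟩, p, rfl⟩

theorem eq_of_path_zero {a : ℕ} {ha : a ≤ n} {hy : y ≤ n}
    (p : Quiver.Path (BVertex.P 0 a (Nat.zero_le n) ha) (BVertex.P 0 y (Nat.zero_le n) hy)) :
    a = y := by
  cases p with
  | nil => rfl
  | cons p e =>
    change BArc n _ _ at e
    exact absurd e.rank_lt (Nat.not_lt_zero _)

theorem eq_nil_of_path_zero {a : ℕ} {ha : a ≤ n}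
    (p : Quiver.Path (BVertex.P 0 a (Nat.zero_le n) ha) (BVertex.P 0 a (Nat.zero_le n) ha)) :
    p = .nil := by
  cases p with
  | nil => rfl
  | cons p e =>
    change BArc n _ _ at e
    exact absurd e.rank_lt (Nat.not_lt_zero _)

end Steps

section Families

variable {n k : ℕ} {A A' : DecSeq k (Fin (n + 1))}

/-! ### From families of kinds to families of paths -/

theorem DecSeq.pos_le (g : DecSeq k (Fin (n + 1))) (m : Fin k) : g.pos m ≤ n :=
  Nat.lt_succ_iff.1 (g.1 m).2

namespace NetFam

/-- The paths of a family. -/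
def path : ∀ {i : ℕ} {f : DecSeq k (Fin (n + 1))}, NetFam A i f → ∀ (hi : i ≤ n) (m : Fin k),
    Quiver.Path (BVertex.P 0 (A.pos m) (Nat.zero_le n) (A.pos_le m))
      (BVertex.P i (f.pos m) hi (f.pos_le m))
  | _, _, nil, _, _ => .nil
  | _, _, cons (g := g) (f := f) c ℓ, hi, m =>
    (c.path (Nat.le_of_succ_le hi) m).comp
      (stepPath hi (g.pos_le m) (f.pos_le m) (ℓ.kind m) (ℓ.isStep m))

variable {i : ℕ} {f g : DecSeq k (Fin (n + 1))}

theorem path_cons (c : NetFam A i g) (ℓ : LayerFam n i g.pos f.pos) (hi : i + 1 ≤ n) (m : Fin k) :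
    (cons c ℓ).path hi m = (c.path (Nat.le_of_succ_le hi) m).comp
      (stepPath hi (g.pos_le m) (f.pos_le m) (ℓ.kind m) (ℓ.isStep m)) := rfl

theorem layerArcs_path_eq_nil (c : NetFam A i f) (hi : i ≤ n) (m : Fin k) {j : ℕ} (hj : i ≤ j) :
    layerArcs j (c.path hi m) = [] :=
  layerArcs_eq_nil_of_rank_le _ (Nat.mul_le_mul_left 2 hj)

theorem layerArcs_path_cons (c : NetFam A i g) (ℓ : LayerFam n i g.pos f.pos) (hi : i + 1 ≤ n)
    (m : Fin k) : layerArcs i ((cons c ℓ).path hi m) =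
      layerArcs i (stepPath hi (g.pos_le m) (f.pos_le m) (ℓ.kind m) (ℓ.isStep m)) := by
  rw [path_cons, layerArcs_comp, layerArcs_path_eq_nil c _ m le_rfl, List.nil_append]

theorem layerArcs_path_cons_of_ne (c : NetFam A i g) (ℓ : LayerFam n i g.pos f.pos)
    (hi : i + 1 ≤ n) (m : Fin k) {j : ℕ} (hj : i ≠ j) : layerArcs j ((cons c ℓ).path hi m) =
      layerArcs j (c.path (Nat.le_of_succ_le hi) m) := by
  rw [path_cons, layerArcs_comp, layerArcs_stepPath_of_ne _ _ _ _ _ hj, List.append_nil]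

theorem prod_pathWeight (c : NetFam A i f) (hi : i ≤ n) :
    ∏ m, pathWeight (c.path hi m) = c.weight := by
  induction c with
  | nil => exact Finset.prod_eq_one fun m _ => Quiver.Path.weight_nil _ _
  | cons c ℓ ih =>
    rw [weight, LayerFam.weight, ← ih (Nat.le_of_succ_le hi), ← Finset.prod_mul_distrib]
    refine Finset.prod_congr rfl fun m _ => ?_
    rw [path_cons, pathWeight, Quiver.Path.weight_comp, ← pathWeight, ← pathWeight,
      pathWeight_stepPath]

/-- A vertex of a path through `i + 1` layers is a vertex of the path through the first `i` layers,
or the end point, or the vertex in the middle of the last layer. -/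
theorem mem_vertices_path_cons (c : NetFam A i g) (ℓ : LayerFam n i g.pos f.pos) (hi : i + 1 ≤ n)
    (m : Fin k) (v : BVertex n) : v ∈ ((cons c ℓ).path hi m).vertices ↔
      v ∈ (c.path (Nat.le_of_succ_le hi) m).vertices ∨ v = .P (i + 1) (f.pos m) hi (f.pos_le m) ∨
        ∃ j hj, v = .Q i j hi hj ∧ ℓ.kind m ≠ .horiz ∧ (ℓ.kind m).mid (g.pos m) = 2 * j := by
  rw [path_cons, mem_vertices_comp, mem_vertices_stepPath]
  constructor
  · rintro (h | rfl | h)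
    · exact Or.inl h
    · exact Or.inl (Quiver.Path.end_mem_vertices _)
    · exact Or.inr h
  · rintro (h | h)
    · exact Or.inl h
    · exact Or.inr (Or.inr h)

/-- Ranks confine a common vertex to one stage; there the `P` are separated by the positions and the
`Q` by the heights. -/
theorem notMem_vertices_path (c : NetFam A i f) (hi : i ≤ n) {m m' : Fin k} (hm : m ≠ m')
    {v : BVertex n} (hv : v ∈ (c.path hi m).vertices) : v ∉ (c.path hi m').vertices := by
  induction c with
  | nil =>
    intro hv'
    change v ∈ [_] at hv
    change v ∈ [_] at hv'
    rw [List.mem_singleton] at hv hv'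
    rw [hv, BVertex.P.injEq] at hv'
    exact hm (A.pos_strictAnti.injective hv'.2)
  | @cons i g f c ℓ ih =>
    intro hv'
    rw [mem_vertices_path_cons] at hv hv'
    have hr : ∀ m, v ∈ (c.path (Nat.le_of_succ_le hi) m).vertices → v.rank ≤ 2 * i :=
      fun m h => rank_le_of_mem_vertices _ h
    rcases hv with h | rfl | ⟨j, hj, rfl, h1, h2⟩ <;>
      rcases hv' with h' | h' | ⟨j', hj', h', h1', h2'⟩
    · exact ih _ h h'
    · have := hr _ h
      rw [h', BVertex.rank] at this
      omega
    · have := hr _ h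
      rw [h', BVertex.rank] at this
      omega
    · have := hr _ h'
      rw [BVertex.rank] at this
      omega
    · rw [BVertex.P.injEq] at h'
      exact hm (f.pos_strictAnti.injective h'.2)
    · cases h'
    · have := hr _ h'
      rw [BVertex.rank] at this
      omega
    · cases h'
    · rw [BVertex.Q.injEq] at h'
      exact hm (ℓ.mid.injective (h2.trans (h'.2 ▸ h2'.symm)))

/-- A family of paths is determined by its arcs. -/
theorem eq_of_layerArcs_eq {c c' : NetFam A i f} (hi : i ≤ n)
    (h : ∀ j m, layerArcs j (c.path hi m) = layerArcs j (c'.path hi m)) : c = c' := by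
  induction c with
  | nil => cases c'; rfl
  | @cons i g f c ℓ ih =>
    cases c' with
    | @cons _ g' _ c' ℓ' =>
      have h1 : ∀ m, (ℓ.kind m, g.pos m) = (ℓ'.kind m, g'.pos m) := fun m => by
        have := congrArg decodeArcs (h i m)
        rwa [layerArcs_path_cons, layerArcs_path_cons, decodeArcs_stepPath,
          decodeArcs_stepPath] at this
      obtain rfl : g = g' := Subtype.ext (funext fun m => Fin.ext (Prod.ext_iff.1 (h1 m)).2)
      obtain rfl : ℓ = ℓ' := LayerFam.ext (funext fun m => (Prod.ext_iff.1 (h1 m)).1)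
      congr 1
      refine ih (Nat.le_of_succ_le hi) fun j m => ?_
      rcases eq_or_ne i j with rfl | hj
      · rw [layerArcs_path_eq_nil _ _ _ le_rfl, layerArcs_path_eq_nil _ _ _ le_rfl]
      · rw [← layerArcs_path_cons_of_ne c ℓ hi m hj, h j m, layerArcs_path_cons_of_ne _ _ _ _ hj]

end NetFam

theorem Kind.eq_of_mid_eq {n i x x' y y' : ℕ} {κ κ' : Kind} (h : κ.IsStep n i x y)
    (h' : κ'.IsStep n i x' y') (hm : κ.mid x = κ'.mid x')
    (hQ : ∀ j, ¬ (j ≤ i + 1 ∧ (κ ≠ .horiz ∧ κ.mid x = 2 * j) ∧ κ' ≠ .horiz ∧ κ'.mid x' = 2 * j)) :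
    x = x' := by
  -- A path from `x` can pass only through `Q_x` or `Q_{x+1}`.
  have h1 := hQ x
  have h2 := hQ (x + 1)
  cases κ <;> cases κ' <;>
    simp only [IsStep, mid, ne_eq, not_true_eq_false, reduceCtorEq, not_false_eq_true, true_and,
      false_and, and_false, and_true] at h h' hm h1 h2 <;> omega

/-- Every family of disjoint paths comes from a family of kinds. -/
theorem exists_netFam_path_eq {i : ℕ} (hi : i ≤ n) (f : Fin k → Fin (n + 1))
    (p : ∀ m, Quiver.Path (BVertex.P 0 (A.pos m) (Nat.zero_le n) (A.pos_le m))
      (BVertex.P i (f m) hi (Nat.lt_succ_iff.1 (f m).2)))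
    (hp : ∀ m m', m ≠ m' → ∀ v, v ∈ (p m).vertices → v ∉ (p m').vertices) :
    ∃ (hf : StrictAnti f) (c : NetFam A i ⟨f, hf⟩), ∀ m, c.path hi m = p m := by
  induction i generalizing f with
  | zero =>
    obtain rfl : f = A.1 := funext fun m => Fin.ext (eq_of_path_zero (p m)).symm
    exact ⟨A.2, .nil, fun m => (eq_nil_of_path_zero (p m)).symm⟩
  | succ i ih =>
    choose x hx κ hκ p' hpp using fun m => exists_eq_comp_stepPath (p m)
    have hmem : ∀ m v, v ∈ (p m).vertices ↔ v ∈ (p' m).vertices ∨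
        v ∈ (stepPath hi (hx m) (Nat.lt_succ_iff.1 (f m).2) (κ m) (hκ m)).vertices := by
      intro m v
      rw [hpp m, mem_vertices_comp]
    obtain ⟨hg, c, hc⟩ := ih (Nat.le_of_succ_le hi) (fun m => ⟨x m, Nat.lt_succ_iff.2 (hx m)⟩) p'
      (fun m m' hm v hv hv' => hp m m' hm v ((hmem m v).2 (Or.inl hv)) ((hmem m' v).2 (Or.inl hv')))
    have hx' : StrictAnti x := fun a b hab => hg hab
    -- The induction hypothesis orders the starts; order can then be lost only by a meeting, which
    -- disjointness forbids, first at the middle and then at the end of the layer.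
    have hmid : StrictAnti fun m => (κ m).mid (x m) := by
      intro a b hab
      refine (hκ a).mid_lt_of_ne (hκ b) (hx' hab) fun he => ?_
      refine (hx' hab).ne (Kind.eq_of_mid_eq (hκ b) (hκ a) he ?_)
      rintro j ⟨hj, ⟨h1, h2⟩, h3, h4⟩
      refine hp a b hab.ne (.Q i j hi hj) ((hmem _ _).2 (Or.inr ?_)) ((hmem _ _).2 (Or.inr ?_))
      · exact (mem_vertices_stepPath _ _ _ _ _ _).2 (Or.inr (Or.inr ⟨j, hj, rfl, h3, h4⟩))
      · exact (mem_vertices_stepPath _ _ _ _ _ _).2 (Or.inr (Or.inr ⟨j, hj, rfl, h1, h2⟩))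
    have hf : StrictAnti f := by
      intro a b hab
      refine lt_of_le_of_ne ((hκ a).le_of_mid_lt (hκ b) (hmid hab)) fun he => ?_
      refine hp a b hab.ne _ (Quiver.Path.end_mem_vertices _) ?_
      have hv := Quiver.Path.end_mem_vertices (p b)
      simp only [he] at hv
      exact hv
    refine ⟨hf, .cons c ⟨κ, hκ, hmid⟩, fun m => ?_⟩
    rw [NetFam.path_cons, hc, hpp]

end Families

/-! ### Polynomials with nonnegative coefficients -/

theorem QNonneg.one : QNonneg 1 := fun d => by
  rw [coeff_one]
  split_ifs <;> norm_num

theorem QNonneg.X : QNonneg X := fun d => by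
  rw [coeff_X]
  split_ifs <;> norm_num

theorem QNonneg.mul {p q : ℝ[X]} (hp : QNonneg p) (hq : QNonneg q) : QNonneg (p * q) := fun d => by
  rw [coeff_mul]
  exact Finset.sum_nonneg fun x _ => mul_nonneg (hp _) (hq _)

theorem QNonneg.prod {ι : Type*} {s : Finset ι} {p : ι → ℝ[X]} (h : ∀ i ∈ s, QNonneg (p i)) :
    QNonneg (∏ i ∈ s, p i) :=
  Finset.prod_induction p QNonneg (fun _ _ => QNonneg.mul) QNonneg.one h

theorem QNonneg.sum {ι : Type*} {s : Finset ι} {p : ι → ℝ[X]} (h : ∀ i ∈ s, QNonneg (p i)) :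
    QNonneg (∑ i ∈ s, p i) := fun d => by
  rw [finsetSum_coeff]
  exact Finset.sum_nonneg fun i hi => h i hi d

theorem QNonneg.tEntry (m : ℕ) : QNonneg (tEntry m) := fun d => by
  rw [NarayanaB.tEntry]
  split_ifs
  · exact QNonneg.one d
  · rw [show (2 : ℝ[X]) = C 2 from rfl, coeff_C_mul_X_pow]
    split_ifs <;> norm_num

/-! ### The excluded properties -/

section Excluded

variable {n i k x y : ℕ}

theorem layerArcs_stepPath_skip (hi : i < n) (hx : x ≤ n) (hy : y ≤ n) {κ : Kind}
    (h : κ.IsStep n i x y) (hκ : κ = .skip) :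
    layerArcs i (stepPath hi hx hy κ h) = [lArc (.skip i hi)] := by
  subst hκ
  obtain ⟨rfl, rfl⟩ := h
  exact layerArcs_one _ _ (by rfl)

theorem layerArcs_stepPath_late_self (hi : i < n) (hx : x ≤ n) (hy : y ≤ n) {κ : Kind}
    (h : κ.IsStep n i x y) (hκ : κ = .late) (hxi : x = i) :
    layerArcs i (stepPath hi hx hy κ h) =
      [lArc (.pq i i hi (by omega)), lArc (.qpLeft i hi)] := by
  subst hκ hxi
  obtain ⟨-, rfl⟩ := h
  exact (congrArg (layerArcs x) (stepPath_late_self hi hx hy _)).trans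
    (layerArcs_two _ _ _ (by rfl) (by rfl))

theorem layerArcs_stepPath_late (hi : i < n) (hx : x ≤ n) (hy : y ≤ n) {κ : Kind}
    (h : κ.IsStep n i x y) (hκ : κ = .late) {z : ℕ} (hz : z < i) (hxz : x = z) :
    layerArcs i (stepPath hi hx hy κ h) =
      [lArc (.pq i z hi (by omega)), lArc (.qpUp i z hi hz)] := by
  subst hκ hxz
  obtain ⟨-, rfl⟩ := h
  exact (congrArg (layerArcs i) (stepPath_late_of_lt hi hx hy _ hz)).trans
    (layerArcs_two _ _ _ (by rfl) (by rfl))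

theorem layerArcs_stepPath_early (hi : i < n) (hx : x ≤ n) (hy : y ≤ n) {κ : Kind}
    (h : κ.IsStep n i x y) (hκ : κ = .early) {z : ℕ} (hz : z ≤ i) (hxz : x = z) :
    layerArcs i (stepPath hi hx hy κ h) =
      [lArc (.pqUp i z hi hz), lArc (.qp i (z + 1) hi (by omega))] := by
  subst hκ hxz
  obtain ⟨-, rfl⟩ := h
  exact layerArcs_two _ _ _ (by rfl) (by rfl)

/-- Consecutive occupied positions belong to consecutive indices; this translates the patterns,
stated by position, into `Prop3`, stated by component number. -/
theorem exists_index_of_occupied {g : Fin k → ℕ} (hg : StrictAnti g) {s : ℕ} {m : Fin k}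
    (hm : g m = i) (h : ∀ x, s ≤ x → x ≤ i → ∃ m, g m = x) {t : ℕ} (ht : s + t ≤ i) :
    ∃ hk : m + t < k, g ⟨m + t, hk⟩ = i - t := by
  induction t with
  | zero => exact ⟨m.2, hm⟩
  | succ t ih =>
    obtain ⟨hk, hgt⟩ := ih (by omega)
    obtain ⟨m', hm'⟩ := h (i - (t + 1)) (by omega) (by omega)
    have h1 : (m + t : ℕ) < m' := by
      have : (⟨m + t, hk⟩ : Fin k) < m' := hg.lt_iff_gt.1 (by omega)
      exact Fin.lt_def.1 this
    have hk' : m + (t + 1) < k := by omega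
    refine ⟨hk', ?_⟩
    have h2 : g ⟨m + (t + 1), hk'⟩ < g ⟨m + t, hk⟩ := hg (by rw [Fin.lt_def]; simp only; omega)
    have h3 : g m' ≤ g ⟨m + (t + 1), hk'⟩ :=
      hg.antitone (by rw [Fin.le_def]; simp only; omega)
    omega

/-- One of the three excluded properties. -/
def Excluded (i : ℕ) (hi : i < n) (c : Fin k → List (AnyArc n)) : Prop :=
  Prop1 i hi c ∨ Prop2 i hi c ∨ Prop3 i hi c

theorem not_excluded_of_eq_nil (hi : i < n) {c : Fin k → List (AnyArc n)} (h : ∀ m, c m = []) :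
    ¬ Excluded i hi c := by
  rintro (⟨j, hj⟩ | ⟨j, hj⟩ | ⟨j, l, _, _, hk, hj, _⟩)
  · rw [h] at hj
    cases hj
  · rw [h] at hj
    cases hj
  · rw [h] at hj
    cases hj

variable {g f : Fin k → ℕ}

/-- `Prop1` is the presence of a skip pattern, `Prop2` a late pattern with `s = i`, and `Prop3` one
with `s = i + 1 - l < i`. -/
theorem LayerFam.excluded_iff (hg : StrictAnti g) (hi : i < n) (hgn : ∀ m, g m ≤ n)
    (hfn : ∀ m, f m ≤ n) (ℓ : LayerFam n i g f) :
    Excluded i hi (fun m => layerArcs i (stepPath hi (hgn m) (hfn m) (ℓ.kind m) (ℓ.isStep m))) ↔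
      ℓ.Bad := by
  have hd : ∀ m, decodeArcs (layerArcs i (stepPath hi (hgn m) (hfn m) (ℓ.kind m) (ℓ.isStep m))) =
      (ℓ.kind m, g m) := fun m => decodeArcs_stepPath _ _ _ _ _
  constructor
  · rintro (⟨m, hm⟩ | ⟨m, hm⟩ | ⟨j, l, hl, hli, hk, hm, ht⟩)
    · have := (congrArg decodeArcs hm).symm.trans (hd m)
      exact LayerFam.bad_of_skip (Prod.ext_iff.1 this).1.symm
    · have := (congrArg decodeArcs hm).symm.trans (hd m)
      exact Or.inl ⟨i, le_rfl, fun x h1 h2 => absurd h2 (not_le_of_gt h1),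
        m, (Prod.ext_iff.1 this).2.symm, (Prod.ext_iff.1 this).1.symm⟩
    · have := (congrArg decodeArcs hm).symm.trans (hd _)
      refine Or.inl ⟨i + 1 - l, by omega, fun x h1 h2 => ?_,
        _, (Prod.ext_iff.1 this).2.symm, (Prod.ext_iff.1 this).1.symm⟩
      have h3 := (congrArg decodeArcs (ht (i - x) (by omega))).symm.trans (hd _)
      refine ⟨_, (Prod.ext_iff.1 h3).2.symm.trans ?_, (Prod.ext_iff.1 h3).1.symm⟩
      exact Nat.sub_sub_self h2
  · rintro (⟨s, h⟩ | ⟨s, h⟩)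
    · rcases h.le.eq_or_lt with rfl | hs
      · obtain ⟨m, hm, hκ⟩ := h.late
        exact Or.inr (Or.inl ⟨m, layerArcs_stepPath_late_self _ _ _ _ hκ hm⟩)
      · obtain ⟨m, hm⟩ := h.occupied h.le le_rfl
        have hidx := fun t => exists_index_of_occupied hg hm (fun x => h.occupied (x := x)) (t := t)
        obtain ⟨hk, hgk⟩ := hidx (i - s) (by omega)
        have e : (m : ℕ) + (i + 1 - s) - 1 = m + (i - s) := by omega
        -- The block starts at the path from `i`, with index `m`, and ends at the path from `s`,
        -- with index `m + (i - s)`.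
        refine Or.inr (Or.inr ⟨m, i + 1 - s, by omega, by omega, by omega, ?_, fun t ht => ?_⟩)
        · have hgk' : g ⟨m + (i + 1 - s) - 1, by omega⟩ = i + 1 - (i + 1 - s) := by
            simp only [e, hgk]
            omega
          refine layerArcs_stepPath_late _ _ _ _ ?_ _ hgk'
          rw [h.apply_eq hg (by omega) (by omega), if_pos (by omega)]
        · obtain ⟨hkt, hgt⟩ := hidx t (by omega)
          refine layerArcs_stepPath_early _ _ _ _ ?_ _ hgt
          rw [h.apply_eq hg (by omega) (by omega), if_neg (by omega)]
    · obtain ⟨m, hm, hκ⟩ := h.skip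
      exact Or.inl ⟨m, layerArcs_stepPath_skip _ _ _ _ hκ⟩

end Excluded

/-! ### The excluded properties in the half network -/

section FullFamilies

variable {n k : ℕ} {A A' : DecSeq k (Fin (n + 1))}

namespace NetFam

variable {i : ℕ} {f : DecSeq k (Fin (n + 1))}

theorem bad_iff (c : NetFam A i f) (hi : i ≤ n) :
    c.Bad ↔ ∃ (j : ℕ) (hj : j < n), Excluded j hj (fun m => layerArcs j (c.path hi m)) := by
  induction c with
  | nil =>
    refine ⟨False.elim, ?_⟩
    rintro ⟨j, hj, h⟩
    exact not_excluded_of_eq_nil hj (fun m => rfl) h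
  | @cons i g f c ℓ ih =>
    rw [Bad, ih (Nat.le_of_succ_le hi),
      ← ℓ.excluded_iff g.pos_strictAnti hi g.pos_le f.pos_le]
    have h1 : Excluded i hi (fun m => layerArcs i ((cons c ℓ).path hi m)) ↔ Excluded i hi (fun m =>
        layerArcs i (stepPath hi (g.pos_le m) (f.pos_le m) (ℓ.kind m) (ℓ.isStep m))) := by
      simp only [layerArcs_path_cons]
    have h2 : ∀ j (hj : j < n), i ≠ j → (Excluded j hj (fun m => layerArcs j ((cons c ℓ).path hi m))
        ↔ Excluded j hj (fun m => layerArcs j (c.path (Nat.le_of_succ_le hi) m))) := by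
      intro j hj hij
      simp only [layerArcs_path_cons_of_ne c ℓ hi _ hij]
    rw [← h1]
    constructor
    · rintro (⟨j, hj, h⟩ | h)
      · rcases eq_or_ne i j with rfl | hij
        · exact (not_excluded_of_eq_nil hj
            (fun m => layerArcs_path_eq_nil c _ m le_rfl) h).elim
        · exact ⟨j, hj, (h2 j hj hij).2 h⟩
      · exact ⟨i, hi, h⟩
    · rintro ⟨j, hj, h⟩
      rcases eq_or_ne i j with rfl | hij
      · exact Or.inr h
      · exact Or.inl ⟨j, hj, (h2 j hj hij).1 h⟩

/-- A layer flip keeps its end points, so the arcs of all other layers stay in place. -/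
theorem exists_layerArcs_flip_eq (c : NetFam A i f) (hi : i ≤ n) : ∃ j₀, ∀ j, j ≠ j₀ → ∀ m,
    layerArcs j (c.flip.path hi m) = layerArcs j (c.path hi m) := by
  induction c with
  | nil => exact ⟨0, fun _ _ _ => rfl⟩
  | @cons i g f c ℓ ih =>
    by_cases hc : c.Bad
    · rw [flip_cons_of_bad hc]
      obtain ⟨j₀, hj₀⟩ := ih (Nat.le_of_succ_le hi)
      refine ⟨j₀, fun j hj m => ?_⟩
      rcases eq_or_ne i j with rfl | hij
      · rw [layerArcs_path_cons, layerArcs_path_cons]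
      · rw [layerArcs_path_cons_of_ne _ _ _ _ hij, layerArcs_path_cons_of_ne _ _ _ _ hij,
          hj₀ j hj]
    · rw [flip_cons_of_not_bad hc]
      refine ⟨i, fun j hj m => ?_⟩
      rw [layerArcs_path_cons_of_ne _ _ _ _ hj.symm, layerArcs_path_cons_of_ne _ _ _ _ hj.symm]

theorem qNonneg_weight {c : NetFam A i f} (h : ¬ c.Bad) : QNonneg c.weight := by
  induction c with
  | nil => exact QNonneg.one
  | cons c ℓ ih =>
    rw [Bad, not_or] at h
    refine (ih h.1).mul (QNonneg.prod fun m _ => ?_)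
    have hs : ℓ.kind m ≠ .skip := fun hs => h.2 (LayerFam.bad_of_skip hs)
    cases hκ : ℓ.kind m <;> first | exact absurd hκ hs | exact QNonneg.one | exact QNonneg.X

end NetFam

/-! ### The nonintersecting families of paths through the whole network -/

namespace FullFam

theorem qNonneg_weight {t : FullFam A A'} (h : ¬ t.Bad) : QNonneg t.weight := by
  rw [Bad, not_or] at h
  exact (NetFam.qNonneg_weight h.1).mul
    ((QNonneg.prod fun m _ => QNonneg.tEntry _).mul (NetFam.qNonneg_weight h.2))

variable {I J : Fin k → Fin (n + 1)} {hI : StrictMono I} {hJ : StrictMono J}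

/-- The paths of a family. -/
def family (t : FullFam (revSeq hI) (revSeq hJ)) : Family I J := fun m =>
  joinPath (t.2.1.path le_rfl m) (t.2.2.path le_rfl m)

theorem family_apply (t : FullFam (revSeq hI) (revSeq hJ)) (m : Fin k) :
    t.family m = joinPath (t.2.1.path le_rfl m) (t.2.2.path le_rfl m) := rfl

theorem familyWeight_family (t : FullFam (revSeq hI) (revSeq hJ)) :
    familyWeight t.family = t.weight := by
  rw [weight, ← NetFam.prod_pathWeight _ le_rfl, ← NetFam.prod_pathWeight _ le_rfl,
    ← Finset.prod_mul_distrib, ← Finset.prod_mul_distrib]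
  exact Finset.prod_congr rfl fun m _ => weight_joinPath _ _

theorem family_mem_nonintersecting (t : FullFam (revSeq hI) (revSeq hJ)) :
    t.family ∈ nonintersecting I J := by
  intro m m' hm v hv hv'
  rw [family_apply] at hv hv'
  rcases (mem_vertices_joinPath _ _ _).1 hv with ⟨x, hx, rfl⟩ | ⟨x, hx, rfl⟩ <;>
    rcases (mem_vertices_joinPath _ _ _).1 hv' with ⟨x', hx', h⟩ | ⟨x', hx', h⟩
  · cases h
    exact t.2.1.notMem_vertices_path le_rfl hm hx hx'
  · cases h
  · cases h
  · cases h
    exact t.2.2.notMem_vertices_path le_rfl hm hx hx'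

theorem restrict_left_family (t : FullFam (revSeq hI) (revSeq hJ)) (i : ℕ) (m : Fin k) :
    restrict (.left i) (t.family m) = layerArcs i (t.2.1.path le_rfl m) :=
  restrict_left_joinPath _ _ _

theorem restrict_right_family (t : FullFam (revSeq hI) (revSeq hJ)) (i : ℕ) (m : Fin k) :
    restrict (.right i) (t.family m) = reflect (layerArcs i (t.2.2.path le_rfl m)) :=
  restrict_right_joinPath _ _ _

theorem restrict_middle_family (t : FullFam (revSeq hI) (revSeq hJ)) (m : Fin k) :
    restrict .middle (t.family m) = [⟨_, _, Arc.middle (t.1.pos m) (t.1.pos_le m)⟩] :=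
  restrict_middle_joinPath _ _

/-- The middle arcs reveal `f`, the arcs on the left determine the first half, and the reflected
arcs on the right the second. -/
theorem family_injective :
    Function.Injective (family : FullFam (revSeq hI) (revSeq hJ) → Family I J) := by
  rintro ⟨f, c, d⟩ ⟨f', c', d'⟩ h
  obtain rfl : f = f' := by
    refine Subtype.ext (funext fun m => Fin.ext ?_)
    have h1 := congrArg (fun p : Family I J => (restrict .middle (p m)).map arcTag) h
    simp only [restrict_middle_family] at h1
    exact (Prod.ext_iff.1 (List.singleton_injective h1)).2
  obtain rfl : c = c' := NetFam.eq_of_layerArcs_eq le_rfl fun j m => by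
    have h1 := congrArg (fun p : Family I J => restrict (.left j) (p m)) h
    simpa only [restrict_left_family] using h1
  obtain rfl : d = d' := NetFam.eq_of_layerArcs_eq le_rfl fun j m => by
    have h1 := congrArg (fun p : Family I J => reflect (restrict (.right j) (p m))) h
    simpa only [restrict_right_family, reflect_reflect] using h1
  rfl

/-- Split each path at its middle arc; disjointness makes both halves families of kinds with the
same middle positions. -/
theorem exists_family_eq (hI : StrictMono I) (hJ : StrictMono J) {p : Family I J}
    (hp : p ∈ nonintersecting I J) :
    ∃ t : FullFam (revSeq hI) (revSeq hJ), t.family = p := by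
  choose y hy p₁ p₂ hpp using fun m => exists_eq_joinPath (p m)
  have h1 : ∀ m m', m ≠ m' → ∀ v, v ∈ (p₁ m).vertices → v ∉ (p₁ m').vertices := by
    intro m m' hm v hv hv'
    refine hp m m' hm (.left v) ?_ ?_
    · rw [hpp m]
      exact (mem_vertices_joinPath _ _ _).2 (Or.inl ⟨v, hv, rfl⟩)
    · rw [hpp m']
      exact (mem_vertices_joinPath _ _ _).2 (Or.inl ⟨v, hv', rfl⟩)
  have h2 : ∀ m m', m ≠ m' → ∀ v, v ∈ (p₂ m).vertices → v ∉ (p₂ m').vertices := by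
    intro m m' hm v hv hv'
    refine hp m m' hm (.right v) ?_ ?_
    · rw [hpp m]
      exact (mem_vertices_joinPath _ _ _).2 (Or.inr ⟨v, hv, rfl⟩)
    · rw [hpp m']
      exact (mem_vertices_joinPath _ _ _).2 (Or.inr ⟨v, hv', rfl⟩)
  obtain ⟨hf, c, hc⟩ := exists_netFam_path_eq (A := revSeq hI) le_rfl
    (fun m => ⟨y m, Nat.lt_succ_iff.2 (hy m)⟩) p₁ h1
  obtain ⟨hf', d, hd⟩ := exists_netFam_path_eq (A := revSeq hJ) le_rfl
    (fun m => ⟨y m, Nat.lt_succ_iff.2 (hy m)⟩) p₂ h2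
  refine ⟨⟨⟨_, hf⟩, c, d⟩, funext fun m => ?_⟩
  rw [hpp m, family_apply, ← hc m, ← hd m]
  rfl

theorem family_mem_goodFamilies_iff (t : FullFam (revSeq hI) (revSeq hJ)) :
    t.family ∈ goodFamilies I J ↔ ¬ t.Bad := by
  rw [Bad, NetFam.bad_iff _ le_rfl, NetFam.bad_iff _ le_rfl]
  simp only [goodFamilies, Set.mem_ofPred_eq, restrict_left_family, restrict_right_family,
    reflect_reflect, t.family_mem_nonintersecting, true_and, Excluded, not_or, not_exists]
  exact forall₂_and

/-- The bijection between families of kinds and nonintersecting families of paths. -/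
noncomputable def equiv (hI : StrictMono I) (hJ : StrictMono J) :
    FullFam (revSeq hI) (revSeq hJ) ≃ nonintersecting I J :=
  Equiv.ofBijective (fun t => ⟨t.family, t.family_mem_nonintersecting⟩)
    ⟨fun _ _ h => family_injective (congrArg Subtype.val h), fun p =>
      (exists_family_eq hI hJ p.2).imp fun _ h => Subtype.ext h⟩

theorem equiv_apply (t : FullFam (revSeq hI) (revSeq hJ)) : (equiv hI hJ t).1 = t.family := rfl

open Classical in
theorem gf_goodFamilies (hI : StrictMono I) (hJ : StrictMono J) : GF (goodFamilies I J) =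
    ∑ t : FullFam (revSeq hI) (revSeq hJ) with ¬ t.Bad, t.weight := by
  have h : goodFamilies I J = Finset.image (family (hI := hI) (hJ := hJ))
      (Finset.univ.filter fun t => ¬ t.Bad) := by
    ext p
    simp only [Finset.coe_image, Set.mem_image, Finset.coe_filter, Finset.mem_univ, true_and,
      Set.mem_ofPred_eq]
    constructor
    · intro hp
      obtain ⟨t, rfl⟩ := exists_family_eq hI hJ hp.1
      exact ⟨t, (family_mem_goodFamilies_iff t).1 hp, rfl⟩
    · rintro ⟨t, ht, rfl⟩
      exact (family_mem_goodFamilies_iff t).2 ht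
  rw [GF, h, finsum_mem_coe_finset, Finset.sum_image family_injective.injOn]
  exact Finset.sum_congr rfl fun t _ => familyWeight_family t

theorem isSegmentwiseSignReversing (hI : StrictMono I) (hJ : StrictMono J) :
    IsSegmentwiseSignReversing (goodFamilies I J)
      (fun p => equiv hI hJ ((equiv hI hJ).symm p).flip) := by
  have key : ∀ t : FullFam (revSeq hI) (revSeq hJ), ((equiv hI hJ).symm (equiv hI hJ t)) = t :=
    fun t => Equiv.symm_apply_apply _ t
  refine ⟨fun p => ?_, fun p => ?_, fun p hp => ?_, fun p => ?_⟩ <;>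
    obtain ⟨t, rfl⟩ := (equiv hI hJ).surjective p
  · simp only [key, flip_flip]
  · simp only [key, (equiv hI hJ).injective.eq_iff, equiv_apply, family_mem_goodFamilies_iff]
    exact flip_eq_iff
  · rw [equiv_apply, family_mem_goodFamilies_iff, not_not] at hp
    simp only [key, equiv_apply, familyWeight_family]
    exact weight_flip hp
  · simp only [key, equiv_apply]
    by_cases h : t.2.1.Bad
    · obtain ⟨j₀, hj₀⟩ := t.2.1.exists_layerArcs_flip_eq le_rfl
      refine ⟨.left j₀, fun s hs m => ?_⟩
      rw [flip_of_bad h]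
      cases s with
      | left j =>
        rw [restrict_left_family, restrict_left_family]
        exact hj₀ j (fun e => hs (congrArg _ e)) m
      | middle => rw [restrict_middle_family, restrict_middle_family]
      | right j => rw [restrict_right_family, restrict_right_family]
    · obtain ⟨j₀, hj₀⟩ := t.2.2.exists_layerArcs_flip_eq le_rfl
      refine ⟨.right j₀, fun s hs m => ?_⟩
      rw [flip_of_not_bad_left h]
      cases s with
      | left j => rw [restrict_left_family, restrict_left_family]
      | middle => rw [restrict_middle_family, restrict_middle_family]
      | right j =>
        rw [restrict_right_family, restrict_right_family]
        exact congrArg _ (hj₀ j (fun e => hs (congrArg _ e)) m)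

end FullFam

/-! ### Minors as generating functions, and total positivity -/

theorem det_hankelTrunc_eq_gf {I J : Fin k → Fin (n + 1)} (hI : StrictMono I)
    (hJ : StrictMono J) : ((hankelTrunc n).submatrix I J).det = GF (goodFamilies I J) := by
  rw [FullFam.gf_goodFamilies hI hJ, FullFam.sum_weight_not_bad, FullFam.sum_weight]

theorem qNonneg_det_hankelTrunc {I J : Fin k → Fin (n + 1)} (hI : StrictMono I)
    (hJ : StrictMono J) : QNonneg ((hankelTrunc n).submatrix I J).det := by
  classical
  rw [det_hankelTrunc_eq_gf hI hJ, FullFam.gf_goodFamilies hI hJ]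
  exact QNonneg.sum fun t ht => FullFam.qNonneg_weight (Finset.mem_filter.1 ht).2

theorem qTotallyPositive_hankel : QTotallyPositive hankel := by
  intro k I J hI hJ
  -- The sum of all indices is a crude bound, so every minor of `hankel` is one of a truncation.
  have hI' : ∀ m, I m < (∑ m, I m) + (∑ m, J m) + 1 := fun m =>
    Nat.lt_succ_iff.2 ((Finset.single_le_sum (fun _ _ => Nat.zero_le _) (Finset.mem_univ m)).trans
      (Nat.le_add_right _ _))
  have hJ' : ∀ m, J m < (∑ m, I m) + (∑ m, J m) + 1 := fun m =>
    Nat.lt_succ_iff.2 ((Finset.single_le_sum (fun _ _ => Nat.zero_le _) (Finset.mem_univ m)).trans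
      (Nat.le_add_left _ _))
  exact qNonneg_det_hankelTrunc (I := fun m => ⟨I m, hI' m⟩) (J := fun m => ⟨J m, hJ' m⟩)
    (fun _ _ h => hI h) (fun _ _ h => hJ h)

end FullFamilies

end NarayanaB

theorem mainTheorem2 :
    (∀ (n k : ℕ) (I J : Fin k → Fin (n + 1)), StrictMono I → StrictMono J →
      (NarayanaB.nonintersecting I J).Finite ∧
      ((NarayanaB.hankelTrunc n).submatrix I J).det =
        NarayanaB.GF (NarayanaB.goodFamilies I J) ∧
      ∃ φ : NarayanaB.nonintersecting I J → NarayanaB.nonintersecting I J,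
        NarayanaB.IsSegmentwiseSignReversing (NarayanaB.goodFamilies I J) φ) ∧
    NarayanaB.QTotallyPositive NarayanaB.hankel :=
  ⟨fun _ _ _ _ hI hJ =>
    ⟨@Set.toFinite _ _ (Finite.of_equiv _ (NarayanaB.FullFam.equiv hI hJ)),
      NarayanaB.det_hankelTrunc_eq_gf hI hJ,
      _, NarayanaB.FullFam.isSegmentwiseSignReversing hI hJ⟩,
    NarayanaB.qTotallyPositive_hankel⟩
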